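/- Let $\Sigma$ be a set of atoms. Modal formulas are built from $\Sigma$ with $\neg,\wedge,\vee,\supset$ and one modality $K$; interpretations are maps $I:\Sigma\to\{\mathbf t,\mathbf f\}$, and $\mathcal A$ is the set of all of them. A belief pair is $B=(P,S)$ with $S\subseteq P\subseteq\mathcal A$, ordered by $(P,S)\le_p(P',S')$ iff $P'\subseteq P$ and $S\subseteq S'$. With the truth order $\mathbf f<\mathbf u<\mathbf t$, the value $\mathcal H_{B,I}(F)\in\{\mathbf f,\mathbf u,\mathbf t\}$ is $I(F)$ on atoms, is given by the strong Kleene tables on the connectives ($\min$ for $\wedge$, $\max$ for $\vee$, $\neg$ exchanges $\mathbf t,\mathbf f$ and fixes $\mathbf u$, $F\supset G$ is treated as $\neg F\vee G$), and $\mathcal H_{B,I}(KF)$ is $\mathbf t$ if $\mathcal H_{B,J}(F)=\mathbf t$ for all $J\in P$, is $\mathbf f$ if $\mathcal H_{B,J}(F)=\mathbf f$ for some $J\in S$, and is $\mathbf u$ otherwise. For a modal theory $T$ put $$D_T(B)=\bigl(\{I:\mathcal H_{B,I}(F)\ne\mathbf f\ \forall F\in T\},\ \{I:\mathcal H_{B,I}(F)=\mathbf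 t\ \forall F\in T\}\bigr).$$ A 3-FOL theory is a set $Y$ of propositional formulas with constants $\mathbf t,\mathbf f,\mathbf u$. Let $\overline F$ (resp. $\underline F$) be $F$ with positive occurrences of $\mathbf u$ replaced by $\mathbf t$ (resp. $\mathbf f$) and negative ones by $\mathbf f$ (resp. $\mathbf t$), and let $\overline Y,\underline Y$ be defined elementwise. $Y$ represents the belief pair $Bel(Y)=(Mod(\overline Y),Mod(\underline Y))$. For a modal formula $F$, let $F_Y$ be the 3-FOL formula obtained by replacing, innermost first, each $K(G)$ by $\mathbf t$ if $\overline Y\vdash\underline{G_Y}$, by $\mathbf f$ if $\underline Y\not\vdash\overline{G_Y}$, and by $\mathbf u$ otherwise, where $\vdash$ is classical propositional provability. Put $\mathcal S_T(Y)=\{F_Y:F\in T\}$. Then: (1) Let $T$ be a finite modal theory and let $N$ be the number of distinct modal literals $K(G)$ that occur in $T$ outside the scope of any other $K$. Starting from the initial instance $\mathcal S_T(\{\mathbf u\})$, at most $N$ further iterations of $\mathcal S_T$ reach a fixpoint of $\mathcal S_T$; that is, for some $k\le N$ the theory $Y=\mathcal S_T^{k}(\mathcal S_T(\{\mathbf u\}))$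 satisfies $\mathcal S_T(Y)=Y$, and $Bel(Y)$ is the $\le_p$-least fixpoint of $D_T$. (2) Suppose that the atoms have distinct binary words as names, so that formulas and finite theories can be written as words over a finite alphabet. There is a function that maps each finite modal theory $T$ to a finite 3-FOL theory $Y$ with $\mathcal S_T(Y)=Y$ such that $Bel(Y)$ is the $\le_p$-least fixpoint of $D_T$, the length of $Y$ is bounded by a polynomial in the length of $T$, and $Y$ is computed from $T$ by a deterministic Turing machine in polynomial time with polynomially many calls to an oracle for propositional provability (does $U\vdash F$ hold, for a finite propositional theory $U$ and a propositional formula $F$ with constants $\mathbf t,\mathbf f$?). Moreover, this function can be computed in deterministic polynomial time with an oracle from $\mathrm{NP}$, i.e. it is in the function version of $\Delta^P_2=\mathrm P^{\mathrm{NP}}$. -/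

import Mathlib

universe u

namespace AEL

/-! ### Truth values -/

/-- The three truth values, listed in the truth ordering `f < u < t`. -/
inductive TV
  | f
  | u
  | t
  deriving DecidableEq

/-- Position in the truth ordering. -/
def TV.rank : TV → ℕ
  | .f => 0
  | .u => 1
  | .t => 2

theorem TV.rank_injective : Function.Injective TV.rank := by
  intro a b h
  cases a <;> cases b <;> first | rfl | exact absurd h (by decide)

/-- The truth ordering. -/
instance : LinearOrder TV := LinearOrder.lift' TV.rank TV.rank_injective

/-- The inverse of a truth value. -/
def TV.inv : TV → TV
  | .f => .t
  | .u => .u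
  | .t => .f

/-- A two-valued truth value as a three-valued one. -/
def TV.ofBool : Bool → TV
  | true => .t
  | false => .f

/-! ### Languages -/

/-- Formulas of propositional modal logic with the single modality `K` over the atoms `At`. -/
inductive Modal (At : Type u) : Type u
  | atom (a : At)
  | neg (F : Modal At)
  | and (F G : Modal At)
  | or (F G : Modal At)
  | imp (F G : Modal At)
  | K (F : Modal At)

/-- Propositional formulas over the atoms `At` with constants from `C`. -/
inductive Fol (C : Type) (At : Type u) : Type u
  | const (c : C)
  | atom (a : At)
  | neg (F : Fol C At)
  | and (F G : Fol C At)
  | or (F G : Fol C At)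
  | imp (F G : Fol C At)

/-- 3-FOL: propositional logic with the constants `t`, `f`, `u`. -/
abbrev Fol3 (At : Type u) : Type u := Fol TV At

/-- 2-FOL: propositional logic with the constants `t`, `f`. -/
abbrev Fol2 (At : Type u) : Type u := Fol Bool At

/-- Two-valued interpretations. -/
abbrev Interp (At : Type u) : Type u := At → Bool

/-! ### Belief pairs and the derivation operator -/

/-- Belief pairs `(P, S)` with `S ⊆ P`. -/
@[ext]
structure BeliefPair (At : Type u) where
  P : Set (Interp At)
  S : Set (Interp At)
  sub : S ⊆ P

/-- The ordering `≤_p` of belief pairs. -/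
instance (At : Type u) : PartialOrder (BeliefPair At) where
  le B₁ B₂ := B₂.P ⊆ B₁.P ∧ B₁.S ⊆ B₂.S
  le_refl B := ⟨subset_rfl, subset_rfl⟩
  le_trans _ _ _ h h' := ⟨h'.1.trans h.1, h.2.trans h'.2⟩
  le_antisymm _ _ h h' :=
    BeliefPair.ext (Set.Subset.antisymm h'.1 h.1) (Set.Subset.antisymm h.2 h'.2)

open Classical in
/-- The truth value `H_{B,I}(F)` of a modal formula. -/
noncomputable def val {At : Type u} (B : BeliefPair At) : Modal At → Interp At → TV
  | .atom a, I => TV.ofBool (I a)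
  | .neg F, I => (val B F I).inv
  | .and F G, I => min (val B F I) (val B G I)
  | .or F G, I => max (val B F I) (val B G I)
  | .imp F G, I => max (val B G I) (val B F I).inv
  | .K F, _ =>
      if ∀ J ∈ B.P, val B F J = .t then .t
      else if ∃ J ∈ B.S, val B F J = .f then .f
      else .u

/-- The derivation operator `D_T`: the interpretations that weakly satisfy `T`, and those that
strongly satisfy `T`. -/
noncomputable def D {At : Type u} (T : Set (Modal At)) (B : BeliefPair At) : BeliefPair At where
  P := {I | ∀ F ∈ T, val B F I ≠ .f}
  S := {I | ∀ F ∈ T, val B F I = .t}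
  sub := fun I hI F hF h => by
    have := hI F hF
    rw [h] at this
    cases this

/-! ### 2-FOL: satisfaction and provability -/

/-- Truth of a 2-FOL formula in an interpretation. -/
def Fol.eval {At : Type u} (I : Interp At) : Fol2 At → Bool
  | .const c => c
  | .atom a => I a
  | .neg F => !(Fol.eval I F)
  | .and F G => Fol.eval I F && Fol.eval I G
  | .or F G => Fol.eval I F || Fol.eval I G
  | .imp F G => !(Fol.eval I F) || Fol.eval I G

/-- `Mod(U)`. -/
def Models {At : Type u} (U : Set (Fol2 At)) : Set (Interp At) :=
  {I | ∀ F ∈ U, Fol.eval I F = true}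

/-- Provability in 2-FOL: natural deduction for classical propositional logic. -/
inductive Prov {At : Type u} : Set (Fol2 At) → Fol2 At → Prop
  | ax {U : Set (Fol2 At)} {F : Fol2 At} : F ∈ U → Prov U F
  | trueI {U : Set (Fol2 At)} : Prov U (.const true)
  | falseE {U : Set (Fol2 At)} {F : Fol2 At} : Prov U (.const false) → Prov U F
  | negI {U : Set (Fol2 At)} {F : Fol2 At} :
      Prov (insert F U) (.const false) → Prov U (.neg F)
  | negE {U : Set (Fol2 At)} {F : Fol2 At} :
      Prov U (.neg F) → Prov U F → Prov U (.const false)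
  | raa {U : Set (Fol2 At)} {F : Fol2 At} :
      Prov (insert (.neg F) U) (.const false) → Prov U F
  | andI {U : Set (Fol2 At)} {F G : Fol2 At} : Prov U F → Prov U G → Prov U (.and F G)
  | andE₁ {U : Set (Fol2 At)} {F G : Fol2 At} : Prov U (.and F G) → Prov U F
  | andE₂ {U : Set (Fol2 At)} {F G : Fol2 At} : Prov U (.and F G) → Prov U G
  | orI₁ {U : Set (Fol2 At)} {F G : Fol2 At} : Prov U F → Prov U (.or F G)
  | orI₂ {U : Set (Fol2 At)} {F G : Fol2 At} : Prov U G → Prov U (.or F G)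
  | orE {U : Set (Fol2 At)} {F G H : Fol2 At} :
      Prov U (.or F G) → Prov (insert F U) H → Prov (insert G U) H → Prov U H
  | impI {U : Set (Fol2 At)} {F G : Fol2 At} : Prov (insert F U) G → Prov U (.imp F G)
  | impE {U : Set (Fol2 At)} {F G : Fol2 At} : Prov U (.imp F G) → Prov U F → Prov U G

/-! ### 3-FOL theories as representations of belief pairs -/

/-- Replace the positive occurrences of `u` by the constant `b` and the negative ones by `!b`. -/
def Fol.approx {At : Type u} : Bool → Fol3 At → Fol2 At
  | b, .const .u => .const b
  | _, .const .t => .const true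
  | _, .const .f => .const false
  | _, .atom a => .atom a
  | b, .neg F => .neg (Fol.approx (!b) F)
  | b, .and F G => .and (Fol.approx b F) (Fol.approx b G)
  | b, .or F G => .or (Fol.approx b F) (Fol.approx b G)
  | b, .imp F G => .imp (Fol.approx (!b) F) (Fol.approx b G)

/-- The overlined formula: positive `u` becomes `t`, negative `u` becomes `f`. -/
def Fol.over {At : Type u} (F : Fol3 At) : Fol2 At := Fol.approx true F

/-- The underlined formula: positive `u` becomes `f`, negative `u` becomes `t`. -/
def Fol.under {At : Type u} (F : Fol3 At) : Fol2 At := Fol.approx false F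

theorem Fol.eval_over_of_under {At : Type u} (I : Interp At) (F : Fol3 At) :
    Fol.eval I F.under = true → Fol.eval I F.over = true := by
  simp only [Fol.over, Fol.under]
  induction F with
  | const c => cases c <;> simp [Fol.approx, Fol.eval]
  | atom a => simp [Fol.approx]
  | neg F ih =>
    simp only [Fol.approx, Fol.eval, Bool.not_true, Bool.not_false]
    cases h : Fol.eval I (Fol.approx false F) <;> simp_all
  | and F G ihF ihG =>
    simp only [Fol.approx, Fol.eval, Bool.and_eq_true]
    exact fun h => ⟨ihF h.1, ihG h.2⟩
  | or F G ihF ihG =>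
    simp only [Fol.approx, Fol.eval, Bool.or_eq_true]
    exact fun h => h.imp ihF ihG
  | imp F G ihF ihG =>
    simp only [Fol.approx, Fol.eval, Bool.or_eq_true, Bool.not_true, Bool.not_false]
    refine fun h => h.imp ?_ ihG
    cases h : Fol.eval I (Fol.approx false F) <;> simp_all

/-- `Bel(Y)`, the belief pair that the 3-FOL theory `Y` represents. -/
def Bel {At : Type u} (Y : Set (Fol3 At)) : BeliefPair At where
  P := Models (Fol.over '' Y)
  S := Models (Fol.under '' Y)
  sub := by
    rintro I hI _ ⟨F, hF, rfl⟩
    exact Fol.eval_over_of_under I F (hI _ ⟨F, hF, rfl⟩)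

open Classical in
/-- The truth value that a 3-FOL theory `Y` gives to `K(F)`, for objective `F`. -/
noncomputable def valK {At : Type u} (Y : Set (Fol3 At)) (F : Fol3 At) : TV :=
  if Prov (Fol.over '' Y) F.under then .t
  else if ¬ Prov (Fol.under '' Y) F.over then .f
  else .u

/-- Replace the modal atoms of a modal formula by their truth values according to `Y`, the nested
ones first. -/
noncomputable def inst {At : Type u} (Y : Set (Fol3 At)) : Modal At → Fol3 At
  | .atom a => .atom a
  | .neg F => .neg (inst Y F)
  | .and F G => .and (inst Y F) (inst Y G)
  | .or F G => .or (inst Y F) (inst Y G)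
  | .imp F G => .imp (inst Y F) (inst Y G)
  | .K F => .const (valK Y (inst Y F))

/-- The operator that sends a 3-FOL theory `Y` to the `Y`-instance of `T`. -/
noncomputable def SD {At : Type u} (T : Set (Modal At)) (Y : Set (Fol3 At)) : Set (Fol3 At) :=
  inst Y '' T

/-- The modal literals `K(G)` that occur in a formula outside the scope of every other `K`. -/
def Modal.top {At : Type u} : Modal At → Set (Modal At)
  | .atom _ => ∅
  | .neg F => F.top
  | .and F G => F.top ∪ G.top
  | .or F G => F.top ∪ G.top
  | .imp F G => F.top ∪ G.top
  | .K F => {.K F}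

/-- The top-level modal literals of a theory. -/
def topLiterals {At : Type u} (T : Set (Modal At)) : Set (Modal At) :=
  ⋃ F ∈ T, F.top

/-! ### Oracle Turing machines -/

/-- A deterministic Turing machine with finitely many stacks (Mathlib's TM2 model), finite control
and an oracle for languages over `Γq`; `Γi` and `Γo` are the input and output alphabets. A label
carries either a statement to execute, or an oracle call about the word on stack `kq`, after
which the machine continues at the label selected by the answer. -/
structure OracleTM (Γi Γo Γq : Type) where
  /-- index type of the stacks -/
  K : Type
  [decK : DecidableEq K]
  [finK : Fintype K]
  /-- the stack alphabet -/
  A : Type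
  [finA : Fintype A]
  /-- function labels -/
  Λ : Type
  [finΛ : Fintype Λ]
  /-- internal states -/
  σ : Type
  [finσ : Fintype σ]
  /-- input, output and query stacks -/
  ki : K
  ko : K
  kq : K
  inp : Γi ↪ A
  out : Γo ↪ A
  qry : Γq ↪ A
  main : Λ
  start : σ
  prog : Λ → Turing.TM2.Stmt (fun _ : K => A) Λ σ ⊕ (Bool → Λ)

namespace OracleTM

variable {Γi Γo Γq : Type} (M : OracleTM Γi Γo Γq)

instance : DecidableEq M.K := M.decK

/-- Configurations; the label `none` means that the machine has halted. -/
abbrev Cfg : Type := Turing.TM2.Cfg (fun _ : M.K => M.A) M.Λ M.σ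

/-- The initial configuration: the input, first symbol on top, is on stack `ki` and the other
stacks are empty. -/
def init (x : List Γi) : M.Cfg where
  l := some M.main
  var := M.start
  stk := Function.update (fun _ => []) M.ki (x.map M.inp)

open Classical in
/-- `M.Reach O n k c c'`: with oracle `O` the machine goes from `c` to `c'` in `n` steps, of which
`k` are oracle calls. A call counts as one step and erases the query stack. -/
inductive Reach (O : Set (List Γq)) : ℕ → ℕ → M.Cfg → M.Cfg → Prop
  | refl (c : M.Cfg) : Reach O 0 0 c c
  | step {n k : ℕ} {l : M.Λ} {v : M.σ} {stk : M.K → List M.A} {c : M.Cfg}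
      {s : Turing.TM2.Stmt (fun _ : M.K => M.A) M.Λ M.σ} :
      M.prog l = .inl s → Reach O n k (Turing.TM2.stepAux s v stk) c →
      Reach O (n + 1) k ⟨some l, v, stk⟩ c
  | call {n k : ℕ} {l : M.Λ} {v : M.σ} {stk : M.K → List M.A} {c : M.Cfg}
      {next : Bool → M.Λ} :
      M.prog l = .inr next →
      Reach O n k ⟨some (next (decide (stk M.kq ∈ List.map M.qry '' O))), v,
        Function.update stk M.kq []⟩ c →
      Reach O (n + 1) (k + 1) ⟨some l, v, stk⟩ c

/-- On input `x` and with oracle `O`, the machine halts with output `y` after at most `time` steps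
and at most `calls` oracle calls. -/
def Outputs (O : Set (List Γq)) (x : List Γi) (y : List Γo) (time calls : ℕ) : Prop :=
  ∃ (n k : ℕ) (v : M.σ) (stk : M.K → List M.A),
    n ≤ time ∧ k ≤ calls ∧ M.Reach O n k (M.init x) ⟨none, v, stk⟩ ∧ stk M.ko = y.map M.out

end OracleTM

/-- `f` is computed, relative to the encodings `ea` and `eb`, by a deterministic machine with
oracle `O` in polynomial time with polynomially many oracle calls. -/
def PolyTimeIn {α : Type*} {β : Type*} {Γi Γo Γq : Type} (O : Set (List Γq))
    (ea : α → List Γi) (eb : β → List Γo) (f : α → β) : Prop :=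
  ∃ (M : OracleTM Γi Γo Γq) (p q : Polynomial ℕ), ∀ a : α,
    M.Outputs O (ea a) (eb (f a)) (p.eval (ea a).length) (q.eval (ea a).length)

/-- Polynomial time without an oracle: the oracle is the empty language over the empty alphabet. -/
def PolyTime {α : Type*} {β : Type*} {Γi Γo : Type}
    (ea : α → List Γi) (eb : β → List Γo) (f : α → β) : Prop :=
  PolyTimeIn (∅ : Set (List Empty)) ea eb f

/-- The class NP: languages with polynomially bounded certificates (binary words) that are checked
in polynomial time. -/
def InNP {Γ : Type} (L : Set (List Γ)) : Prop :=
  ∃ (V : List Γ × List Bool → Bool) (q : Polynomial ℕ),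
    PolyTime (fun xw : List Γ × List Bool => xw.1.map Sum.inl ++ xw.2.map Sum.inr)
      (fun b : Bool => [b]) V ∧
    ∀ x : List Γ, x ∈ L ↔ ∃ w : List Bool, w.length ≤ q.eval x.length ∧ V (x, w) = true

/-- The function version of `Δ^P_2 = P^NP`: polynomial time with an oracle from NP. -/
def InFDeltaP2 {α : Type*} {β : Type*} {Γi Γo : Type}
    (ea : α → List Γi) (eb : β → List Γo) (f : α → β) : Prop :=
  ∃ (Γ : Type) (L : Set (List Γ)), InNP L ∧ PolyTimeIn L ea eb f

/-! ### Formulas and theories as words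

Formulas are written in Polish notation, where an atom is written as its name (a binary word)
between `var` and `close`. Each formula of a finite theory is followed by `sep`. -/

/-- The symbols used to write formulas and theories. -/
inductive Sym
  | var
  | bit (b : Bool)
  | close
  | tt
  | ff
  | uu
  | neg
  | and
  | or
  | imp
  | box
  | sep
  | turnstile
  deriving DecidableEq, Fintype

section Encoding

variable {At : Type u} (name : At → List Bool)

def encAtom (a : At) : List Sym := .var :: ((name a).map .bit ++ [.close])

def encModal : Modal At → List Sym
  | .atom a => encAtom name a
  | .neg F => .neg :: encModal F
  | .and F G => .and :: (encModal F ++ encModal G)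
  | .or F G => .or :: (encModal F ++ encModal G)
  | .imp F G => .imp :: (encModal F ++ encModal G)
  | .K F => .box :: encModal F

def encFol {C : Type} (ec : C → Sym) : Fol C At → List Sym
  | .const c => [ec c]
  | .atom a => encAtom name a
  | .neg F => .neg :: encFol ec F
  | .and F G => .and :: (encFol ec F ++ encFol ec G)
  | .or F G => .or :: (encFol ec F ++ encFol ec G)
  | .imp F G => .imp :: (encFol ec F ++ encFol ec G)

def encTV : TV → Sym
  | .t => .tt
  | .f => .ff
  | .u => .uu

def encBool : Bool → Sym
  | true => .tt
  | false => .ff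

/-- A finite modal theory as a word. -/
def encModalTheory (T : List (Modal At)) : List Sym :=
  T.flatMap fun F => encModal name F ++ [.sep]

/-- A finite 3-FOL theory as a word. -/
def encFol3Theory (Y : List (Fol3 At)) : List Sym :=
  Y.flatMap fun F => encFol name encTV F ++ [.sep]

/-- A finite 2-FOL theory `U` and a 2-FOL formula `F`, as a word. -/
def encSequent (U : List (Fol2 At)) (F : Fol2 At) : List Sym :=
  (U.flatMap fun G => encFol name encBool G ++ [.sep]) ++ .turnstile :: encFol name encBool F

/-- The propositional provability oracle: the pairs `(U, F)` with `U` finite and `U ⊢ F`. -/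
def provLang : Set (List Sym) :=
  {x | ∃ (U : List (Fol2 At)) (F : Fol2 At), x = encSequent name U F ∧ Prov {G | G ∈ U} F}

end Encoding

end AEL

namespace AEL

section Logic

variable {At : Type u}

/-! ### Soundness and completeness of propositional provability -/

/-! The symbolic operator mirrors the semantic one: for finite `Y`, `Bel (SD T Y) = D T (Bel Y)`
(`Bel_SD`). By induction on the modal formula, the underlined instance is true at `I` exactly when
the three-valued value is `t`, and the overlined one exactly when it is not `f`
(`eval_approx_inst`). In the case of `K` the two provability tests of `valK` become quantifiers over
`P` and `S`, by soundness and completeness of the calculus for finite theories (`prov_iff`).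

The initial theory `{u}` represents the least belief pair, and `D T` is monotone (`val_mono`). Hence
the represented pairs ascend along the iteration and stay below every fixpoint of `D T`; as soon as
the iteration reaches a fixpoint of `SD T`, it represents the least fixpoint of `D T`.

For the bound `N`, an instance depends only on the values of the top-level modal literals
(`inst_congr`). Along the ascending chain such a value can change only from `u` to `t` or `f`, once.
If no literal becomes decided between two consecutive stages, the next two theories coincide
(`stage_stable_of_decided`); at most `N` stages can decide a new one (`exists_stage_fixed`).

For the complexity claim, the function iterates `|T| + 1` times, where `|T|` is the length of the
word for `T`. This is enough because `N ≤ |T|` and a fixpoint, once reached, persists. No instance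
of `T` is longer than `T`, since `K(G)` becomes one symbol, and each box costs at most two queries
per round. The algorithm is written as a structured program whose steps are counted by `Exec`, and
`reach_of_exec` turns it into an oracle machine with the same step count, plus one step for halting.

For `P^NP` the same program runs with the answers of the oracle exchanged. The NP language is
unprovability: a certificate is a list of truth values that are substituted in turn for the first
remaining atom, after which the sequent is evaluated. Only agreement on well-formed sequents
matters, because the program asks about nothing else (`encSequent_mem_unprovLang`). -/

theorem Prov.sound {U : Set (Fol2 At)} {F : Fol2 At} (h : Prov U F) :
    ∀ I ∈ Models U, Fol.eval I F = true := by
  have key : ∀ {I : Interp At} {U : Set (Fol2 At)} {F : Fol2 At},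
      I ∈ Models U → Fol.eval I F = true → I ∈ Models (insert F U) := by
    rintro I U F hU hF G (rfl | hG)
    · exact hF
    · exact hU G hG
  induction h with
  | ax h => exact fun I hI => hI _ h
  | trueI => exact fun _ _ => rfl
  | falseE _ ih => exact fun I hI => absurd (ih I hI) (by simp [Fol.eval])
  | @negI U F _ ih =>
    intro I hI
    by_contra hF
    have hF' : Fol.eval I F = true := by simpa [Fol.eval] using hF
    exact absurd (ih I (key hI hF')) (by simp [Fol.eval])
  | negE _ _ ih₁ ih₂ =>
    intro I hI
    have h₁ := ih₁ I hI
    have h₂ := ih₂ I hI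
    simp [Fol.eval, h₂] at h₁
  | @raa U F _ ih =>
    intro I hI
    by_contra hF
    have hF' : Fol.eval I (.neg F) = true := by simpa [Fol.eval] using hF
    exact absurd (ih I (key hI hF')) (by simp [Fol.eval])
  | andI _ _ ih₁ ih₂ => exact fun I hI => by simp [Fol.eval, ih₁ I hI, ih₂ I hI]
  | andE₁ _ ih => exact fun I hI => by have := ih I hI; simp [Fol.eval] at this; exact this.1
  | andE₂ _ ih => exact fun I hI => by have := ih I hI; simp [Fol.eval] at this; exact this.2
  | orI₁ _ ih => exact fun I hI => by simp [Fol.eval, ih I hI]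
  | orI₂ _ ih => exact fun I hI => by simp [Fol.eval, ih I hI]
  | orE _ _ _ ih₁ ih₂ ih₃ =>
    intro I hI
    have := ih₁ I hI
    simp only [Fol.eval, Bool.or_eq_true] at this
    rcases this with h | h
    · exact ih₂ I (key hI h)
    · exact ih₃ I (key hI h)
  | @impI U F G _ ih =>
    intro I hI
    cases hF : Fol.eval I F
    · simp [Fol.eval, hF]
    · simp [Fol.eval, ih I (key hI hF)]
  | impE _ _ ih₁ ih₂ =>
    intro I hI
    have := ih₁ I hI
    simpa [Fol.eval, ih₂ I hI] using this

theorem Prov.mono {U V : Set (Fol2 At)} {F : Fol2 At} (h : Prov U F) (hUV : U ⊆ V) :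
    Prov V F := by
  induction h generalizing V with
  | ax h => exact .ax (hUV h)
  | trueI => exact .trueI
  | falseE _ ih => exact .falseE (ih hUV)
  | negI _ ih => exact .negI (ih (Set.insert_subset_insert hUV))
  | negE _ _ ih₁ ih₂ => exact .negE (ih₁ hUV) (ih₂ hUV)
  | raa _ ih => exact .raa (ih (Set.insert_subset_insert hUV))
  | andI _ _ ih₁ ih₂ => exact .andI (ih₁ hUV) (ih₂ hUV)
  | andE₁ _ ih => exact .andE₁ (ih hUV)
  | andE₂ _ ih => exact .andE₂ (ih hUV)
  | orI₁ _ ih => exact .orI₁ (ih hUV)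
  | orI₂ _ ih => exact .orI₂ (ih hUV)
  | orE _ _ _ ih₁ ih₂ ih₃ =>
    exact .orE (ih₁ hUV) (ih₂ (Set.insert_subset_insert hUV)) (ih₃ (Set.insert_subset_insert hUV))
  | impI _ ih => exact .impI (ih (Set.insert_subset_insert hUV))
  | impE _ _ ih₁ ih₂ => exact .impE (ih₁ hUV) (ih₂ hUV)

theorem Prov.weaken {U : Set (Fol2 At)} {F G : Fol2 At} (h : Prov U F) : Prov (insert G U) F :=
  h.mono (Set.subset_insert _ _)

theorem Prov.hyp {U : Set (Fol2 At)} {F : Fol2 At} : Prov (insert F U) F :=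
  .ax (Set.mem_insert _ _)

theorem Prov.cut {U : Set (Fol2 At)} {F G : Fol2 At} (h : Prov (insert F U) G) (hF : Prov U F) :
    Prov U G :=
  .impE (.impI h) hF

/-- Excluded middle, obtained from `raa`: under the assumption that `G` fails, the first derivation
refutes `F` and the second then refutes its negation. -/
theorem Prov.byCases {U : Set (Fol2 At)} (F : Fol2 At) {G : Fol2 At}
    (h₁ : Prov (insert F U) G) (h₂ : Prov (insert (.neg F) U) G) : Prov U G := by
  refine .raa (.cut (F := .neg F) ?_ (.negI ?_))
  · refine .negE (.ax (by simp)) (h₂.mono ?_)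
    exact Set.insert_subset_insert (Set.subset_insert _ _)
  · refine .negE (.ax (by simp)) (h₁.mono ?_)
    exact Set.insert_subset_insert (Set.subset_insert _ _)

/-- The atoms that occur in a propositional formula. -/
def Fol.atoms {C : Type} : Fol C At → List At
  | .const _ => []
  | .atom a => [a]
  | .neg F => F.atoms
  | .and F G => F.atoms ++ G.atoms
  | .or F G => F.atoms ++ G.atoms
  | .imp F G => F.atoms ++ G.atoms

/-- `F` itself if `b` is true, and its negation otherwise. -/
def Fol.signed (b : Bool) (F : Fol2 At) : Fol2 At := if b then F else .neg F

/-- Kalmár's lemma: the literals that describe `I` on the atoms of `F` suffice to derive `F` or its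
negation, whichever is true at `I`. -/
theorem Prov.signed_eval {I : Interp At} {U : Set (Fol2 At)} {F : Fol2 At}
    (h : ∀ a ∈ F.atoms, Prov U (Fol.signed (I a) (.atom a))) :
    Prov U (Fol.signed (Fol.eval I F) F) := by
  induction F with
  | const c =>
    cases c
    · exact .negI .hyp
    · exact .trueI
  | atom a => exact h a (by simp [Fol.atoms])
  | neg F ih =>
    have ih := ih h
    cases hF : Fol.eval I F <;> simp only [hF, Fol.signed, Fol.eval] at ih ⊢ <;> simp at ih ⊢
    · exact ih
    · exact .negI (.negE .hyp ih.weaken)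
  | and F G ihF ihG =>
    have ihF := ihF fun a ha => h a (by simp [Fol.atoms, ha])
    have ihG := ihG fun a ha => h a (by simp [Fol.atoms, ha])
    cases hF : Fol.eval I F <;> cases hG : Fol.eval I G <;>
      simp only [hF, hG, Fol.signed, Fol.eval] at ihF ihG ⊢ <;> simp at ihF ihG ⊢
    · exact .negI (.negE ihF.weaken (.andE₁ .hyp))
    · exact .negI (.negE ihF.weaken (.andE₁ .hyp))
    · exact .negI (.negE ihG.weaken (.andE₂ .hyp))
    · exact .andI ihF ihG
  | or F G ihF ihG =>
    have ihF := ihF fun a ha => h a (by simp [Fol.atoms, ha])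
    have ihG := ihG fun a ha => h a (by simp [Fol.atoms, ha])
    cases hF : Fol.eval I F <;> cases hG : Fol.eval I G <;>
      simp only [hF, hG, Fol.signed, Fol.eval] at ihF ihG ⊢ <;> simp at ihF ihG ⊢
    · exact .negI (.orE .hyp (.negE ihF.weaken.weaken .hyp) (.negE ihG.weaken.weaken .hyp))
    · exact .orI₂ ihG
    · exact .orI₁ ihF
    · exact .orI₁ ihF
  | imp F G ihF ihG =>
    have ihF := ihF fun a ha => h a (by simp [Fol.atoms, ha])
    have ihG := ihG fun a ha => h a (by simp [Fol.atoms, ha])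
    cases hF : Fol.eval I F <;> cases hG : Fol.eval I G <;>
      simp only [hF, hG, Fol.signed, Fol.eval] at ihF ihG ⊢ <;> simp at ihF ihG ⊢
    · exact .impI (.falseE (.negE ihF.weaken .hyp))
    · exact .impI ihG.weaken
    · exact .negI (.negE ihG.weaken (.impE .hyp ihF.weaken))
    · exact .impI ihG.weaken

/-- The literals are discharged one atom at a time by case distinction; this works because the
hypothesis is available for every assignment of signs. -/
theorem Prov.of_literals {U : Set (Fol2 At)} {F : Fol2 At} (as : List At)
    (h : ∀ I : Interp At, Prov (U ∪ (fun a => Fol.signed (I a) (.atom a)) '' {a | a ∈ as}) F) :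
    Prov U F := by
  classical
  induction as with
  | nil => simpa using h fun _ => true
  | cons a as ih =>
    refine ih fun I => Prov.byCases (.atom a) ?_ ?_
    · refine (h (Function.update I a true)).mono ?_
      rintro G (hG | ⟨a', ha', rfl⟩)
      · exact Or.inr (Or.inl hG)
      · by_cases e : a' = a
        · subst e; left; simp [Fol.signed]
        · right; right
          exact ⟨a', by simpa [e] using ha', by simp [Function.update_of_ne e]⟩
    · refine (h (Function.update I a false)).mono ?_
      rintro G (hG | ⟨a', ha', rfl⟩)
      · exact Or.inr (Or.inl hG)
      · by_cases e : a' = a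
        · subst e; left; simp [Fol.signed]
        · right; right
          exact ⟨a', by simpa [e] using ha', by simp [Function.update_of_ne e]⟩

/-- Completeness for finite theories. -/
theorem prov_iff {U : Set (Fol2 At)} (hU : U.Finite) {F : Fol2 At} :
    Prov U F ↔ ∀ I ∈ Models U, Fol.eval I F = true := by
  refine ⟨Prov.sound, fun h => ?_⟩
  obtain ⟨s, rfl⟩ := hU.exists_finset_coe
  -- Finiteness of the theory enters here: all its atoms and those of `F` form one list. For each
  -- assignment, either it is a model and Kalmár's lemma derives `F`, or it falsifies some axiom,
  -- whose negation is then derivable.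
  refine Prov.of_literals (F.atoms ++ s.toList.flatMap Fol.atoms) fun I => ?_
  have lit : ∀ a, (a ∈ F.atoms ∨ ∃ G ∈ s, a ∈ G.atoms) → Prov ((s : Set (Fol2 At)) ∪
      (fun a => Fol.signed (I a) (.atom a)) ''
        {a | a ∈ F.atoms ++ s.toList.flatMap Fol.atoms}) (Fol.signed (I a) (.atom a)) :=
    fun a ha => .ax (Or.inr ⟨a, by simpa using ha, rfl⟩)
  by_cases hI : I ∈ Models (s : Set (Fol2 At))
  · have := Prov.signed_eval (I := I) (F := F) fun a ha => lit a (Or.inl ha)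
    simpa [h I hI, Fol.signed] using this
  · simp only [Models, Set.mem_ofPred_eq, not_forall] at hI
    obtain ⟨G, hG, hG'⟩ := hI
    have := Prov.signed_eval (I := I) (F := G) fun a ha => lit a (Or.inr ⟨G, hG, ha⟩)
    rw [Bool.not_eq_true] at hG'
    simp only [hG', Fol.signed, Bool.false_eq_true, if_false] at this
    exact .falseE (.negE this (.ax (Or.inl hG)))

/-! ### The symbolic operator represents the derivation operator -/

theorem max_eq_t {a b : TV} : max a b = .t ↔ a = .t ∨ b = .t := by
  cases a <;> cases b <;> decide

theorem min_eq_t {a b : TV} : min a b = .t ↔ a = .t ∧ b = .t := by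
  cases a <;> cases b <;> decide

theorem max_eq_f {a b : TV} : max a b = .f ↔ a = .f ∧ b = .f := by
  cases a <;> cases b <;> decide

theorem min_eq_f {a b : TV} : min a b = .f ↔ a = .f ∨ b = .f := by
  cases a <;> cases b <;> decide

theorem inv_eq_t {a : TV} : a.inv = .t ↔ a = .f := by cases a <;> decide

theorem inv_eq_f {a : TV} : a.inv = .f ↔ a = .t := by cases a <;> decide

/-- Both equivalences have to be proved together, since negation and the antecedent of an
implication exchange the two approximations. -/
theorem eval_approx_inst {Y : Set (Fol3 At)} (hY : Y.Finite) (F : Modal At) (I : Interp At) :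
    (Fol.eval I (inst Y F).under = true ↔ val (Bel Y) F I = .t) ∧
      (Fol.eval I (inst Y F).over = true ↔ val (Bel Y) F I ≠ .f) := by
  simp only [Fol.under, Fol.over]
  induction F generalizing I with
  | atom a => cases h : I a <;> simp [inst, Fol.approx, Fol.eval, val, TV.ofBool, h]
  | neg F ih =>
    simp only [inst, Fol.approx, Fol.eval, val, Bool.not_false, Bool.not_true, inv_eq_t, ne_eq,
      inv_eq_f, Bool.not_eq_true']
    rw [← Bool.not_eq_true, ← Bool.not_eq_true, (ih I).1, (ih I).2]
    simp
  | and F G ihF ihG =>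
    simp only [inst, Fol.approx, Fol.eval, val, Bool.and_eq_true, min_eq_t, ne_eq, min_eq_f,
      (ihF I).1, (ihF I).2, (ihG I).1, (ihG I).2]
    tauto
  | or F G ihF ihG =>
    simp only [inst, Fol.approx, Fol.eval, val, Bool.or_eq_true, max_eq_t, ne_eq, max_eq_f,
      (ihF I).1, (ihF I).2, (ihG I).1, (ihG I).2]
    tauto
  | imp F G ihF ihG =>
    simp only [inst, Fol.approx, Fol.eval, val, Bool.or_eq_true, max_eq_t, ne_eq, max_eq_f,
      Bool.not_false, Bool.not_true, inv_eq_t, inv_eq_f, Bool.not_eq_true']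
    rw [← Bool.not_eq_true, ← Bool.not_eq_true, (ihF I).1, (ihF I).2, (ihG I).1, (ihG I).2]
    tauto
  | K F ih =>
    -- By completeness the provability tests become the quantifiers over `P` and `S` in the
    -- definition of `val`; the induction hypothesis, available at every interpretation, matches
    -- their bodies.
    have h₁ : Prov (Fol.over '' Y) (inst Y F).under ↔ ∀ J ∈ (Bel Y).P, val (Bel Y) F J = .t := by
      rw [prov_iff (hY.image _)]
      exact forall₂_congr fun J _ => (ih J).1
    have h₂ : ¬ Prov (Fol.under '' Y) (inst Y F).over ↔
        ∃ J ∈ (Bel Y).S, val (Bel Y) F J = .f := by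
      rw [prov_iff (hY.image _)]
      push Not
      refine exists_congr fun J => and_congr Iff.rfl ?_
      have := (ih J).2
      simp only [Fol.over]
      tauto
    have : valK Y (inst Y F) = val (Bel Y) (.K F) I := by
      classical
      unfold valK val
      exact if_congr h₁ rfl (if_congr h₂ rfl rfl)
    simp only [inst, this]
    cases val (Bel Y) (.K F) I <;> simp [Fol.approx, Fol.eval]

/-- The instance of `K F` is a constant, and a constant is determined by the truth of its two
approximations. -/
theorem valK_inst {Y : Set (Fol3 At)} (hY : Y.Finite) (F : Modal At) (I : Interp At) :
    valK Y (inst Y F) = val (Bel Y) (.K F) I := by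
  have h := eval_approx_inst hY (.K F) I
  simp only [inst, Fol.under, Fol.over] at h
  revert h
  cases valK Y (inst Y F) <;> cases val (Bel Y) (.K F) I <;> simp [Fol.approx, Fol.eval]

theorem Bel_SD {T : Set (Modal At)} {Y : Set (Fol3 At)} (hY : Y.Finite) :
    Bel (SD T Y) = D T (Bel Y) := by
  ext I
  · change (∀ G ∈ Fol.over '' (inst Y '' T), Fol.eval I G = true) ↔ ∀ F ∈ T, val (Bel Y) F I ≠ .f
    simp only [Set.forall_mem_image]
    exact forall₂_congr fun F _ => (eval_approx_inst hY F I).2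
  · change (∀ G ∈ Fol.under '' (inst Y '' T), Fol.eval I G = true) ↔ ∀ F ∈ T, val (Bel Y) F I = .t
    simp only [Set.forall_mem_image]
    exact forall₂_congr fun F _ => (eval_approx_inst hY F I).1

/-! ### Monotonicity and the least fixpoint -/

/-- The Kleene connectives are monotone in information. For `K`, a more precise pair has fewer
worlds in `P` to check and more witnesses in `S`. -/
theorem val_mono {B B' : BeliefPair At} (h : B ≤ B') (F : Modal At) (I : Interp At) :
    (val B F I = .t → val B' F I = .t) ∧ (val B F I = .f → val B' F I = .f) := by
  induction F generalizing I with
  | atom a => simp [val]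
  | neg F ih =>
    simp only [val, inv_eq_t, inv_eq_f]
    exact ⟨(ih I).2, (ih I).1⟩
  | and F G ihF ihG =>
    simp only [val, min_eq_t, min_eq_f]
    exact ⟨And.imp (ihF I).1 (ihG I).1, Or.imp (ihF I).2 (ihG I).2⟩
  | or F G ihF ihG =>
    simp only [val, max_eq_t, max_eq_f]
    exact ⟨Or.imp (ihF I).1 (ihG I).1, And.imp (ihF I).2 (ihG I).2⟩
  | imp F G ihF ihG =>
    simp only [val, max_eq_t, max_eq_f, inv_eq_t, inv_eq_f]
    exact ⟨Or.imp (ihG I).1 (ihF I).2, And.imp (ihG I).2 (ihF I).1⟩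
  | K F ih =>
    have hS : (∃ J ∈ B.S, val B F J = .f) → ∃ J ∈ B'.S, val B' F J = .f :=
      fun ⟨J, hJ, hv⟩ => ⟨J, h.2 hJ, (ih J).2 hv⟩
    have hP : (∀ J ∈ B.P, val B F J = .t) → ∀ J ∈ B'.P, val B' F J = .t :=
      fun hv J hJ => (ih J).1 (hv J (h.1 hJ))
    -- The definition tries the value `t` before `f`, so preservation of `f` also needs the two
    -- tests to exclude each other; this is where `S ⊆ P` is used.
    have hdis : (∃ J ∈ B'.S, val B' F J = .f) → ¬ ∀ J ∈ B'.P, val B' F J = .t := by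
      rintro ⟨J, hJ, hv⟩ hall
      have := hall J (B'.sub hJ)
      rw [hv] at this
      cases this
    constructor
    · intro hv
      have : ∀ J ∈ B.P, val B F J = .t := by
        by_contra hc
        simp only [val, if_neg hc] at hv
        split_ifs at hv
      simp only [val, if_pos (hP this)]
    · intro hv
      have : ∃ J ∈ B.S, val B F J = .f := by
        by_contra hc
        simp only [val, if_neg hc] at hv
        split_ifs at hv
      simp only [val, if_pos (hS this), if_neg (hdis (hS this))]

theorem D_mono (T : Set (Modal At)) : Monotone (D T) := fun _ _ h =>
  ⟨fun I hI F hF hv => hI F hF ((val_mono h F I).2 hv),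
    fun I hI F hF => (val_mono h F I).1 (hI F hF)⟩

/-- The overlined `u` is satisfied by all interpretations and the underlined one by none, so `{u}`
represents the bottom pair. -/
theorem Bel_const_u_le (B : BeliefPair At) : Bel {(Fol.const TV.u : Fol3 At)} ≤ B := by
  constructor
  · intro I _
    simp [Bel, Models, Fol.over, Fol.approx, Fol.eval]
  · intro I hI
    simp [Bel, Models, Fol.under, Fol.approx, Fol.eval] at hI

/-! ### Stabilization of the iteration. -/

section Iteration

variable {T : Set (Modal At)}

/-- The `j`-th theory of the iteration that starts from `{u}`. -/
noncomputable def stage (T : Set (Modal At)) (j : ℕ) : Set (Fol3 At) :=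
  (SD T)^[j] {Fol.const TV.u}

theorem stage_succ (T : Set (Modal At)) (j : ℕ) : stage T (j + 1) = SD T (stage T j) :=
  Function.iterate_succ_apply' _ _ _

theorem stage_finite (hT : T.Finite) (j : ℕ) : (stage T j).Finite := by
  cases j with
  | zero => exact Set.finite_singleton _
  | succ j => rw [stage_succ]; exact hT.image _

theorem Bel_stage_succ (hT : T.Finite) (j : ℕ) :
    Bel (stage T (j + 1)) = D T (Bel (stage T j)) := by
  rw [stage_succ, Bel_SD (stage_finite hT j)]

theorem Bel_stage_le_succ (hT : T.Finite) (j : ℕ) :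
    Bel (stage T j) ≤ Bel (stage T (j + 1)) := by
  induction j with
  | zero => exact Bel_const_u_le _
  | succ j ih =>
    rw [Bel_stage_succ hT, Bel_stage_succ hT (j + 1)]
    exact D_mono T ih

theorem Bel_stage_le_fixed (hT : T.Finite) (j : ℕ) {B : BeliefPair At}
    (hB : Function.IsFixedPt (D T) B) : Bel (stage T j) ≤ B := by
  induction j with
  | zero => exact Bel_const_u_le _
  | succ j ih =>
    rw [Bel_stage_succ hT, ← hB]
    exact D_mono T ih

/-- Instantiation replaces an outermost `K(G)` as a whole, so nested literals matter only through
the top-level ones. Hence only the latter are counted in `N`. -/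
theorem inst_congr {Y Y' : Set (Fol3 At)} (F : Modal At)
    (h : ∀ G, .K G ∈ F.top → valK Y (inst Y G) = valK Y' (inst Y' G)) :
    inst Y F = inst Y' F := by
  induction F with
  | atom a => rfl
  | neg F ih => simp only [inst]; rw [ih h]
  | and F G ihF ihG =>
    simp only [inst]
    rw [ihF fun H hH => h H (Or.inl hH), ihG fun H hH => h H (Or.inr hH)]
  | or F G ihF ihG =>
    simp only [inst]
    rw [ihF fun H hH => h H (Or.inl hH), ihG fun H hH => h H (Or.inr hH)]
  | imp F G ihF ihG =>
    simp only [inst]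
    rw [ihF fun H hH => h H (Or.inl hH), ihG fun H hH => h H (Or.inr hH)]
  | K F => simp only [inst]; rw [h F rfl]

theorem Modal.top_finite (F : Modal At) : F.top.Finite := by
  induction F with
  | atom a => exact Set.finite_empty
  | neg F ih => exact ih
  | and F G ihF ihG => exact ihF.union ihG
  | or F G ihF ihG => exact ihF.union ihG
  | imp F G ihF ihG => exact ihF.union ihG
  | K F => exact Set.finite_singleton _

theorem topLiterals_finite (hT : T.Finite) : (topLiterals T).Finite :=
  hT.biUnion fun F _ => F.top_finite

/-- The top-level modal literals with a classical truth value at stage `j`. -/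
def decided (T : Set (Modal At)) (j : ℕ) : Set (Modal At) :=
  {H ∈ topLiterals T | val (Bel (stage T j)) H (fun _ => true) ≠ .u}

/-- The interpretation `fun _ => true` in `decided` is a mere placeholder: every member of
`topLiterals T` has the form `K G`, whose value does not depend on it. -/
theorem decided_subset_succ (hT : T.Finite) (j : ℕ) : decided T j ⊆ decided T (j + 1) := by
  rintro H ⟨hH, hv⟩
  refine ⟨hH, ?_⟩
  have := val_mono (Bel_stage_le_succ hT j) H fun _ => true
  revert hv
  cases h : val (Bel (stage T j)) H (fun _ => true)
  · simp [this.2 h]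
  · simp
  · simp [this.1 h]

/-- Classical values persist by monotonicity and, by hypothesis, `u` persists as well. So the two
stages give all top-level literals the same values and therefore have the same instance of `T`. -/
theorem stage_stable_of_decided (hT : T.Finite) {j : ℕ} (h : decided T (j + 1) ⊆ decided T j) :
    stage T (j + 2) = stage T (j + 1) := by
  change stage T (j + 1 + 1) = _
  rw [stage_succ T (j + 1)]
  conv_rhs => rw [stage_succ]
  refine Set.image_congr fun F hF => inst_congr F fun G hG => ?_
  rw [valK_inst (stage_finite hT _) G fun _ => true, valK_inst (stage_finite hT _) G fun _ => true]
  have hmem : .K G ∈ topLiterals T := Set.mem_biUnion hF hG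
  have hm := val_mono (Bel_stage_le_succ hT j) (.K G) fun _ => true
  cases hv : val (Bel (stage T j)) (.K G) fun _ => true
  · exact hm.2 hv
  · by_contra hne
    exact (h ⟨hmem, hne⟩).2 hv
  · exact hm.1 hv

theorem exists_stage_fixed (hT : T.Finite) :
    ∃ k : ℕ, (k : ℕ∞) ≤ (topLiterals T).encard ∧ stage T (k + 2) = stage T (k + 1) := by
  by_contra hc
  push Not at hc
  have hfin := topLiterals_finite hT
  have hdfin : ∀ j, (decided T j).Finite := fun j => hfin.subset fun _ h => h.1
  have grow : ∀ j ≤ (topLiterals T).ncard + 1, j ≤ (decided T j).ncard := by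
    intro j
    induction j with
    | zero => simp
    | succ j ih =>
      intro hj
      have h₁ : (j : ℕ∞) ≤ (topLiterals T).encard := by
        rw [← hfin.cast_ncard_eq]
        exact_mod_cast (by omega : j ≤ (topLiterals T).ncard)
      have hss : decided T j ⊂ decided T (j + 1) :=
        ⟨decided_subset_succ hT j, fun h => hc j h₁ (stage_stable_of_decided hT h)⟩
      have := Set.ncard_lt_ncard hss (hdfin _)
      have := ih (by omega)
      omega
  have h₁ := grow _ le_rfl
  have h₂ := Set.ncard_le_ncard (s := decided T ((topLiterals T).ncard + 1))
    (fun _ h => h.1) hfin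
  omega

/-- A repeated theory represents a fixpoint of `D T`, and every stage lies below every such
fixpoint. -/
theorem isLeast_Bel_stage (hT : T.Finite) {k : ℕ} (h : stage T (k + 1) = stage T k) :
    IsLeast (Function.fixedPoints (D T)) (Bel (stage T k)) := by
  refine ⟨?_, fun B hB => Bel_stage_le_fixed hT k hB⟩
  show D T _ = _
  rw [← Bel_stage_succ hT, h]

theorem stage_eq_of_fixed {k : ℕ} (h : stage T (k + 1) = stage T k) {m : ℕ} (hm : k ≤ m) :
    stage T m = stage T k := by
  induction m, hm using Nat.le_induction with
  | base => rfl
  | succ m _ ih => rw [stage_succ, ih, ← stage_succ, h]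

end Iteration

end Logic

/-! ### Structured programs for oracle machines -/

/-- Structured programs that act on stacks indexed by `K` with the alphabet `A`. -/
inductive Prog (K A : Type) : Type
  | skip
  | push (k : K) (a : A)
  | pop (k : K) (f : Option A → Prog K A)
  | seq (p q : Prog K A)
  | each (k : K) (body : A → Prog K A)
  | ask (p q : Prog K A)

namespace Prog

variable {K A : Type}

/-- Control points of a program. -/
def Lab : Prog K A → Type
  | skip => Unit
  | push _ _ => Unit
  | pop _ f => Unit ⊕ Σ o, Lab (f o)
  | seq p q => Lab p ⊕ Lab q
  | each _ body => Unit ⊕ Σ a, Lab (body a)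
  | ask p q => Unit ⊕ (Lab p ⊕ Lab q)

instance [Finite A] (p : Prog K A) : Finite p.Lab := by
  induction p with
  | skip => exact inferInstanceAs (Finite Unit)
  | push => exact inferInstanceAs (Finite Unit)
  | pop k f ih => exact inferInstanceAs (Finite (Unit ⊕ Σ o, Lab (f o)))
  | seq p q ihp ihq => exact inferInstanceAs (Finite (Lab p ⊕ Lab q))
  | each k body ih => exact inferInstanceAs (Finite (Unit ⊕ Σ a, Lab (body a)))
  | ask p q ihp ihq => exact inferInstanceAs (Finite (Unit ⊕ (Lab p ⊕ Lab q)))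

/-- The first control point. -/
def entry : (p : Prog K A) → p.Lab
  | skip => ()
  | push _ _ => ()
  | pop _ _ => .inl ()
  | seq p _ => .inl p.entry
  | each _ _ => .inl ()
  | ask _ _ => .inl ()

/-- What a machine does at a control point of a program that is embedded by `e` and continues at
`x`. The internal state of the machine is the last popped symbol; `sw` tells whether the answers of
the oracle are exchanged. -/
def code (sw : Bool) {Λ : Type} : (p : Prog K A) → (p.Lab → Λ) → Λ → p.Lab →
    Turing.TM2.Stmt (fun _ : K => A) Λ (Option A) ⊕ (Bool → Λ)
  | skip, _, x, _ => .inl (.goto fun _ => x)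
  | push k a, _, x, _ => .inl (.push k (fun _ => a) (.goto fun _ => x))
  | pop k f, e, _, .inl _ =>
      .inl (.pop k (fun _ o => o) (.goto fun o => e (.inr ⟨o, (f o).entry⟩)))
  | pop _ f, e, x, .inr ⟨o, l⟩ => code sw (f o) (fun l => e (.inr ⟨o, l⟩)) x l
  | seq p q, e, _, .inl l => code sw p (fun l => e (.inl l)) (e (.inr q.entry)) l
  | seq _ q, e, x, .inr l => code sw q (fun l => e (.inr l)) x l
  | each k body, e, x, .inl _ =>
      .inl (.pop k (fun _ o => o) (.goto fun o => match o with
        | none => x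
        | some a => e (.inr ⟨a, (body a).entry⟩)))
  | each _ body, e, _, .inr ⟨a, l⟩ =>
      code sw (body a) (fun l => e (.inr ⟨a, l⟩)) (e (.inl ())) l
  | ask p q, e, _, .inl _ =>
      .inr fun b => if b ^^ sw then e (.inr (.inl p.entry)) else e (.inr (.inr q.entry))
  | ask p _, e, x, .inr (.inl l) => code sw p (fun l => e (.inr (.inl l))) x l
  | ask _ q, e, x, .inr (.inr l) => code sw q (fun l => e (.inr (.inr l))) x l

/-- The machine that runs a program and halts. -/
noncomputable def toTM {Γi Γo Γq : Type} [DecidableEq K] [Fintype K] [Fintype A] (sw : Bool)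
    (p : Prog K A) (ki ko kq : K) (inp : Γi ↪ A) (out : Γo ↪ A) (qry : Γq ↪ A) :
    OracleTM Γi Γo Γq where
  K := K
  A := A
  Λ := Option p.Lab
  finΛ := Fintype.ofFinite _
  σ := Option A
  ki := ki
  ko := ko
  kq := kq
  inp := inp
  out := out
  qry := qry
  main := some p.entry
  start := none
  prog
    | none => .inl .halt
    | some l => code sw p some none l

variable [DecidableEq K]

/-- `Exec Q kq p s s' t`: with oracle `Q` and query stack `kq`, the program `p` leads from the
stacks `s` to the stacks `s'` in `t` steps. -/
inductive Exec (Q : Set (List A)) (kq : K) :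
    Prog K A → (K → List A) → (K → List A) → ℕ → Prop
  | skip {s} : Exec Q kq skip s s 1
  | push {k a s} : Exec Q kq (push k a) s (Function.update s k (a :: s k)) 1
  | pop {k f s s' t} :
      Exec Q kq (f (s k).head?) (Function.update s k (s k).tail) s' t →
      Exec Q kq (pop k f) s s' (t + 1)
  | seq {p q s s' s'' t t'} : Exec Q kq p s s' t → Exec Q kq q s' s'' t' →
      Exec Q kq (seq p q) s s'' (t + t')
  | each_nil {k body s} : s k = [] → Exec Q kq (each k body) s s 1
  | each_cons {k body s a l s' s'' t t'} : s k = a :: l →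
      Exec Q kq (body a) (Function.update s k l) s' t → Exec Q kq (each k body) s' s'' t' →
      Exec Q kq (each k body) s s'' (t + t' + 1)
  | ask_yes {p q s s' t} : s kq ∈ Q → Exec Q kq p (Function.update s kq []) s' t →
      Exec Q kq (ask p q) s s' (t + 1)
  | ask_no {p q s s' t} : s kq ∉ Q → Exec Q kq q (Function.update s kq []) s' t →
      Exec Q kq (ask p q) s s' (t + 1)

end Prog

/-! ### Simulation of structured programs by oracle machines. -/

section Reach

variable {Γi Γo Γq : Type} (M : OracleTM Γi Γo Γq)

theorem OracleTM.Reach.trans {O : Set (List Γq)} {n n' k k' : ℕ} {c c' c'' : M.Cfg}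
    (h : M.Reach O n k c c') (h' : M.Reach O n' k' c' c'') :
    M.Reach O (n + n') (k + k') c c'' := by
  induction h with
  | refl => simpa using h'
  | step hp _ ih =>
    rw [Nat.add_right_comm]
    exact .step hp (ih h')
  | call hp _ ih =>
    rw [Nat.add_right_comm, Nat.add_right_comm _ 1 k']
    exact .call hp (ih h')

theorem OracleTM.Reach.calls_le {O : Set (List Γq)} {n k : ℕ} {c c' : M.Cfg}
    (h : M.Reach O n k c c') : k ≤ n := by
  induction h with
  | refl => exact le_rfl
  | step _ _ ih => omega
  | call _ _ ih => omega

end Reach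

namespace Prog

variable {K A Γi Γo Γq : Type} [DecidableEq K] [Fintype K] [Fintype A]

/-- `hQ` says that `Q` is the oracle language, or its complement if `sw` is true. The statement is
general in the embedding `e` and the exit `x` so that the induction can pass to subprograms. The
number of calls is left open because it never exceeds the number of steps. -/
theorem reach_of_exec {sw : Bool} {p₀ : Prog K A} {ki ko kq : K} {inp : Γi ↪ A} {out : Γo ↪ A}
    {qry : Γq ↪ A} {O : Set (List Γq)} {Q : Set (List A)}
    (hQ : ∀ x, x ∈ Q ↔ ((x ∈ List.map qry '' O) ↔ sw = false))
    {p : Prog K A} {s s' : K → List A} {t : ℕ} (h : Exec Q kq p s s' t) :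
    ∀ (e : p.Lab → Option p₀.Lab) (x : Option p₀.Lab),
      (∀ l, (toTM sw p₀ ki ko kq inp out qry).prog (e l) = code sw p e x l) → ∀ v, ∃ v' k,
      (toTM sw p₀ ki ko kq inp out qry).Reach O t k ⟨some (e p.entry), v, s⟩ ⟨some x, v', s'⟩ := by
  induction h with
  | skip => exact fun e x he v => ⟨v, 0, .step (he ()) (.refl _)⟩
  | push => exact fun e x he v => ⟨v, 0, .step (he ()) (.refl _)⟩
  | @pop k f s s' t _ ih =>
    intro e x he v
    obtain ⟨v', c, hr⟩ := ih (fun l => e (.inr ⟨_, l⟩)) x (fun l => he (.inr ⟨_, l⟩)) (s k).head?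
    exact ⟨v', c, .step (he (.inl ())) hr⟩
  | @seq p q s s' s'' t t' _ _ ih₁ ih₂ =>
    intro e x he v
    obtain ⟨v₁, c₁, h₁⟩ := ih₁ (fun l => e (.inl l)) (e (.inr q.entry)) (fun l => he (.inl l)) v
    obtain ⟨v₂, c₂, h₂⟩ := ih₂ (fun l => e (.inr l)) x (fun l => he (.inr l)) v₁
    exact ⟨v₂, c₁ + c₂, h₁.trans _ h₂⟩
  | @each_nil k body s hs =>
    intro e x he v
    refine ⟨none, 0, .step (he (.inl ())) ?_⟩
    have : Function.update s k [] = s := by rw [← hs, Function.update_eq_self]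
    simp only [Turing.TM2.stepAux, hs]
    erw [this]
    exact .refl _
  | @each_cons k body s a l s' s'' t t' hs _ _ ih₁ ih₂ =>
    intro e x he v
    obtain ⟨v₁, c₁, h₁⟩ := ih₁ (fun l => e (.inr ⟨a, l⟩)) (e (.inl ()))
      (fun l => he (.inr ⟨a, l⟩)) (some a)
    obtain ⟨v₂, c₂, h₂⟩ := ih₂ e x he v₁
    refine ⟨v₂, c₁ + c₂, .step (he (.inl ())) ?_⟩
    simp only [Turing.TM2.stepAux, hs]
    exact h₁.trans _ h₂
  | @ask_yes p q s s' t hs _ ih =>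
    intro e x he v
    obtain ⟨v', c, hr⟩ := ih (fun l => e (.inr (.inl l))) x (fun l => he (.inr (.inl l))) v
    refine ⟨v', c + 1, .call (he (.inl ())) ?_⟩
    classical
    have : (decide (s kq ∈ List.map qry '' O) ^^ sw) = true := by
      have := (hQ _).1 hs
      cases sw <;> simpa using this
    erw [this]
    exact hr
  | @ask_no p q s s' t hs _ ih =>
    intro e x he v
    obtain ⟨v', c, hr⟩ := ih (fun l => e (.inr (.inr l))) x (fun l => he (.inr (.inr l))) v
    refine ⟨v', c + 1, .call (he (.inl ())) ?_⟩
    classical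
    have : (decide (s kq ∈ List.map qry '' O) ^^ sw) = false := by
      have := mt (hQ _).2 hs
      cases sw <;> simpa using this
    erw [this]
    exact hr

theorem outputs_of_exec {sw : Bool} {p : Prog K A} {ki ko kq : K} {inp : Γi ↪ A} {out : Γo ↪ A}
    {qry : Γq ↪ A} {O : Set (List Γq)} {Q : Set (List A)}
    (hQ : ∀ x, x ∈ Q ↔ ((x ∈ List.map qry '' O) ↔ sw = false)) {x : List Γi} {y : List Γo}
    {s : K → List A} {t b : ℕ}
    (h : Exec Q kq p (Function.update (fun _ => []) ki (x.map inp)) s t)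
    (hs : s ko = y.map out) (ht : t + 1 ≤ b) :
    (toTM sw p ki ko kq inp out qry).Outputs O x y b b := by
  -- The whole program exits to the label `none` of the machine, whose statement is `halt`;
  -- executing it is the extra step in `t + 1 ≤ b`.
  obtain ⟨v', k, hr⟩ := reach_of_exec (p₀ := p) (ki := ki) (ko := ko) (inp := inp) (out := out) hQ h
    some none (fun _ => rfl) none
  have hr' := hr.trans _ (.step rfl (.refl _))
  exact ⟨_, _, _, s, ht, (hr'.calls_le).trans ht, hr', hs⟩

end Prog

/-! ### Time bounds and small programs -/

namespace Prog

variable {K A : Type} [DecidableEq K] {Q : Set (List A)} {kq : K}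

/-- The program `p` leads from `s` to `s'` in at most `b` steps. -/
def Runs (Q : Set (List A)) (kq : K) (p : Prog K A) (s s' : K → List A) (b : ℕ) : Prop :=
  ∃ t ≤ b, Exec Q kq p s s' t

theorem Runs.mono {p : Prog K A} {s s' : K → List A} {b b' : ℕ} (h : Runs Q kq p s s' b)
    (hb : b ≤ b') : Runs Q kq p s s' b' :=
  let ⟨t, ht, he⟩ := h
  ⟨t, ht.trans hb, he⟩

theorem Runs.of_eq {p : Prog K A} {s s' s'' : K → List A} {b : ℕ} (h : Runs Q kq p s s' b)
    (e : s' = s'') : Runs Q kq p s s'' b :=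
  e ▸ h

theorem Runs.of_eq_left {p : Prog K A} {s₀ s s' : K → List A} {b : ℕ} (h : Runs Q kq p s s' b)
    (e : s₀ = s) : Runs Q kq p s₀ s' b :=
  e ▸ h

theorem Runs.skip {s : K → List A} : Runs Q kq skip s s 1 := ⟨1, le_rfl, .skip⟩

theorem Runs.push {k : K} {a : A} {s : K → List A} :
    Runs Q kq (push k a) s (Function.update s k (a :: s k)) 1 := ⟨1, le_rfl, .push⟩

theorem Runs.pop {k : K} {f : Option A → Prog K A} {s s' : K → List A} {b : ℕ}
    (h : Runs Q kq (f (s k).head?) (Function.update s k (s k).tail) s' b) :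
    Runs Q kq (pop k f) s s' (b + 1) :=
  let ⟨t, ht, he⟩ := h
  ⟨t + 1, by omega, .pop he⟩

theorem Runs.seq {p q : Prog K A} {s s' s'' : K → List A} {b b' : ℕ} (h : Runs Q kq p s s' b)
    (h' : Runs Q kq q s' s'' b') : Runs Q kq (seq p q) s s'' (b + b') :=
  let ⟨t, ht, he⟩ := h
  let ⟨t', ht', he'⟩ := h'
  ⟨t + t', by omega, .seq he he'⟩

theorem Runs.each_nil {k : K} {body : A → Prog K A} {s : K → List A} (h : s k = []) :
    Runs Q kq (each k body) s s 1 := ⟨1, le_rfl, .each_nil h⟩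

theorem Runs.each_cons {k : K} {body : A → Prog K A} {s s' s'' : K → List A} {a : A} {l : List A}
    {b b' : ℕ} (hs : s k = a :: l) (h : Runs Q kq (body a) (Function.update s k l) s' b)
    (h' : Runs Q kq (each k body) s' s'' b') : Runs Q kq (each k body) s s'' (b + b' + 1) :=
  let ⟨t, ht, he⟩ := h
  let ⟨t', ht', he'⟩ := h'
  ⟨t + t' + 1, by omega, .each_cons hs he he'⟩

theorem Runs.ask_yes {p q : Prog K A} {s s' : K → List A} {b : ℕ} (hs : s kq ∈ Q)
    (h : Runs Q kq p (Function.update s kq []) s' b) : Runs Q kq (ask p q) s s' (b + 1) :=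
  let ⟨t, ht, he⟩ := h
  ⟨t + 1, by omega, .ask_yes hs he⟩

theorem Runs.ask_no {p q : Prog K A} {s s' : K → List A} {b : ℕ} (hs : s kq ∉ Q)
    (h : Runs Q kq q (Function.update s kq []) s' b) : Runs Q kq (ask p q) s s' (b + 1) :=
  let ⟨t, ht, he⟩ := h
  ⟨t + 1, by omega, .ask_no hs he⟩

/-- Sequential composition of a list of programs. -/
def block : List (Prog K A) → Prog K A
  | [] => skip
  | p :: ps => seq p (block ps)

theorem Runs.nil {s : K → List A} : Runs Q kq (block []) s s 1 := Runs.skip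

theorem Runs.cons {p : Prog K A} {ps : List (Prog K A)} {s s' s'' : K → List A} {b b' : ℕ}
    (h : Runs Q kq p s s' b) (h' : Runs Q kq (block ps) s' s'' b') :
    Runs Q kq (block (p :: ps)) s s'' (b + b') := h.seq h'

/-- Put the word `l` on top of stack `k`. -/
def pushes (k : K) : List A → Prog K A
  | [] => skip
  | a :: l => seq (pushes k l) (push k a)

theorem Runs.pushes {k : K} (l : List A) {s : K → List A} :
    Runs Q kq (pushes k l) s (Function.update s k (l ++ s k)) (l.length + 1) := by
  induction l with
  | nil => exact Runs.skip.of_eq (by simp)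
  | cons a l ih =>
    refine ((ih.seq Runs.push).of_eq ?_).mono (by simp)
    simp

/-- Move the contents of stack `k` to stack `k'`, which reverses them. -/
def move (k k' : K) : Prog K A := each k fun a => push k' a

theorem Runs.move {k k' : K} (hk : k ≠ k') (l : List A) {s : K → List A} (hs : s k = l) :
    Runs Q kq (move k k') s
      (Function.update (Function.update s k []) k' (l.reverse ++ s k')) (2 * l.length + 1) := by
  induction l generalizing s with
  | nil =>
    have e : Function.update s k [] = s := by rw [← hs, Function.update_eq_self]
    exact (Runs.each_nil hs).of_eq (by simp [e])
  | cons a l ih =>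
    have h := ih (s := Function.update (Function.update s k l) k' (a :: s k')) (by simp [hk])
    refine ((Runs.each_cons hs (Runs.push.of_eq ?_) h).of_eq ?_).mono ?_
    · simp [hk.symm]
    · funext j
      by_cases h₁ : j = k' <;> by_cases h₂ : j = k <;> simp_all
    · simp; omega

/-- Empty stack `k`. -/
def clear (k : K) : Prog K A := each k fun _ => skip

theorem Runs.clear {k : K} (l : List A) {s : K → List A} (hs : s k = l) :
    Runs Q kq (clear k) s (Function.update s k []) (2 * l.length + 1) := by
  induction l generalizing s with
  | nil => exact (Runs.each_nil hs).of_eq (by simp [← hs])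
  | cons a l ih =>
    have h := ih (s := Function.update s k l) (by simp)
    refine ((Runs.each_cons hs Runs.skip h).of_eq (by simp)).mono ?_
    simp; omega

/-- Move the contents of stack `k` to both `k₁` and `k₂`. -/
def moveBoth (k k₁ k₂ : K) : Prog K A := each k fun a => seq (push k₁ a) (push k₂ a)

theorem Runs.moveBoth {k k₁ k₂ : K} (h₁ : k ≠ k₁) (h₂ : k ≠ k₂) (h₁₂ : k₁ ≠ k₂) (l : List A)
    {s : K → List A} (hs : s k = l) :
    Runs Q kq (moveBoth k k₁ k₂) s
      (Function.update (Function.update (Function.update s k []) k₁ (l.reverse ++ s k₁))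
        k₂ (l.reverse ++ s k₂)) (3 * l.length + 1) := by
  induction l generalizing s with
  | nil =>
    refine (Runs.each_nil hs).of_eq ?_
    funext j
    by_cases e₂ : j = k₂ <;> by_cases e₁ : j = k₁ <;> by_cases e : j = k <;> simp_all
  | cons a l ih =>
    have h := ih (s := Function.update (Function.update (Function.update s k l) k₁ (a :: s k₁)) k₂
      (a :: s k₂)) (by simp [h₁, h₂])
    refine ((Runs.each_cons hs ((Runs.push.seq Runs.push).of_eq ?_) h).of_eq ?_).mono ?_
    · simp [h₁.symm, h₂.symm, h₁₂.symm]
    · funext j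
      by_cases e₂ : j = k₂ <;> by_cases e₁ : j = k₁ <;> by_cases e : j = k <;> simp_all
    · simp; omega

end Prog

/-! ### The program that computes the least fixpoint -/

/-- The stacks of the fixpoint program: the theory (`t`), the reversed theory (`r`), a counter
(`c`), the current 3-FOL theory (`y`), a work stack (`w`), two auxiliary stacks (`z`, `x`), the
reversed query (`g`), the query (`q`) and the pending polarities (`p`). -/
inductive FixStack
  | t | r | c | y | w | z | x | g | q | p
  deriving DecidableEq

instance : Fintype FixStack :=
  ⟨{.t, .r, .c, .y, .w, .z, .x, .g, .q, .p}, fun k => by cases k <;> decide⟩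

namespace FixStack

/-- The stacks with the given contents. -/
def st (t r c y w z x g q p : List Sym) : FixStack → List Sym
  | .t => t
  | .r => r
  | .c => c
  | .y => y
  | .w => w
  | .z => z
  | .x => x
  | .g => g
  | .q => q
  | .p => p

open Prog

/-- The symbol written when the symbol `s` is read with pending polarity (or mode) `m`. -/
def emit : Sym → Sym → Sym
  | .bit b, .uu => encBool b
  | _, s => s

/-- The polarities that become pending when the symbol `s` is read with pending polarity (or
mode) `m`; the mode `var` means that the name of an atom is being read. -/
def pend : Sym → Sym → List Sym
  | .var, .close => []
  | .var, _ => [.var]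
  | .bit _, .var => [.var]
  | .bit b, .neg => [.bit !b]
  | .bit b, .and => [.bit b, .bit b]
  | .bit b, .or => [.bit b, .bit b]
  | .bit b, .imp => [.bit !b, .bit b]
  | .bit b, .sep => [.bit b, .bit b]
  | .bit b, .turnstile => [.bit !b]
  | _, _ => []

/-- One step of the translation of a 3-FOL sequent to a 2-FOL sequent. -/
def translateStep (s : Sym) : Prog FixStack Sym :=
  .pop .p fun o => match o with
    | none => .push .x s
    | some m => block [.push .z s, .push .g (emit m s),
        if s = .turnstile then .pop .p fun _ => pushes .p (pend m s) else pushes .p (pend m s)]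

/-- Translate the sequent on `w` according to the polarities on `p`. The translation is written
reversed to `g`, the sequent is moved to `z`, and what follows the sequent is moved to `x`. -/
abbrev translate : Prog FixStack Sym := .each .w translateStep

/-- Replace the 3-FOL formula on top of `w` by the constant `c`, after translation. -/
def finish (c : Sym) : Prog FixStack Sym := block [clear .z, move .x .w, .push .w c]

/-- The second query of `evalBox`, which distinguishes the values `u` and `f`. -/
def evalBoxUndef : Prog FixStack Sym :=
  block [move .z .w, pushes .p [.bit false, .bit false], translate, move .g .q,
    .ask (finish .uu) (finish .ff)]

/-- Replace the 3-FOL formula `G` on top of `w` by the value of `K G` in the theory on `y`. -/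
def evalBox : Prog FixStack Sym :=
  block [.push .w .turnstile, move .y .z, moveBoth .z .y .w,
    pushes .p [.bit true, .bit true], translate, move .g .q,
    .ask (finish .tt) evalBoxUndef]

/-- One step of the instantiation of a modal theory, which is read from right to left. -/
def instStep (s : Sym) : Prog FixStack Sym :=
  .seq (.push .t s) (if s = .box then evalBox else .push .w s)

/-- Write the instance of the modal theory on `r` to `w` and move the theory to `t`. -/
abbrev instTheory : Prog FixStack Sym := .each .r instStep

/-- Replace the theory on `y` by the instance of the modal theory. -/
def iterate : Prog FixStack Sym :=
  block [instTheory, clear .y, move .w .z, move .z .y, move .t .r]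

/-- The fixpoint program. -/
def fixProg : Prog FixStack Sym :=
  block [moveBoth .t .r .c, .push .c .sep, pushes .y [.uu, .sep], .each .c fun _ => iterate]

/-! ### Correctness and running time of the fixpoint program. -/

section Correctness

variable {At : Type u} (name : At → List Bool) {Q : Set (List Sym)}

theorem runs_translateStep {t r c y w z x g q p : List Sym} {m s : Sym} (hs : s ≠ .turnstile) :
    Runs Q .q (translateStep s) (st t r c y w z x g q (m :: p))
      (st t r c y w (s :: z) x (emit m s :: g) q (pend m s ++ p)) 7 := by
  have hlen : (pend m s).length ≤ 2 := by
    unfold pend; split <;> simp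
  have h : Runs Q .q (block [.push .z s, .push .g (emit m s), pushes .p (pend m s)])
      (st t r c y w z x g q p)
      (st t r c y w (s :: z) x (emit m s :: g) q (pend m s ++ p)) 6 := by
    refine ((Runs.push.cons (Runs.push.cons ((Runs.pushes _).cons Runs.nil))).of_eq ?_).mono ?_
    · funext k; cases k <;> rfl
    · omega
  refine Runs.pop ?_
  have e : Function.update (st t r c y w z x g q (m :: p)) .p p = st t r c y w z x g q p := by
    funext k; cases k <;> rfl
  simpa [st, e, hs] using h

/-- Before each formula of the theory two polarities are pending, one for the formula and one for
the `sep` behind it. The turnstile comes in place of a further formula, so it consumes both. The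
goal gets the opposite polarity, because overlined theories are paired with underlined goals and
conversely. -/
theorem runs_translateStep_turnstile {t r c y w z x g q p : List Sym} {b : Bool} {m : Sym} :
    Runs Q .q (translateStep .turnstile) (st t r c y w z x g q (.bit b :: m :: p))
      (st t r c y w (.turnstile :: z) x (.turnstile :: g) q (.bit (!b) :: p)) 7 := by
  have h : Runs Q .q (block [.push .z .turnstile, .push .g (emit (.bit b) .turnstile),
      .pop .p fun _ => pushes .p (pend (.bit b) .turnstile)])
      (st t r c y w z x g q (m :: p))
      (st t r c y w (.turnstile :: z) x (.turnstile :: g) q (.bit (!b) :: p)) 6 := by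
    refine ((Runs.push.cons (Runs.push.cons ((Runs.pop (Runs.pushes _)).cons Runs.nil))).of_eq
      ?_).mono ?_
    · funext k; cases k <;> rfl
    · simp [pend]
  refine Runs.pop ?_
  have e : Function.update (st t r c y w z x g q (.bit b :: m :: p)) .p (m :: p) =
      st t r c y w z x g q (m :: p) := by
    funext k; cases k <;> rfl
  simpa [st, e] using h

/-- A single loop reads the whole word, so its part that handles one formula is not a program of its
own. This lemma and the following ones are therefore in continuation form: a run from the state
behind the symbols read extends to a run from the state before them, at a cost of 8 steps per
symbol. -/
theorem runs_translate_cons {t r c y w z x g q p : List Sym} {m s : Sym} (hs : s ≠ .turnstile)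
    {s' : FixStack → List Sym} {B : ℕ}
    (h : Runs Q .q translate (st t r c y w (s :: z) x (emit m s :: g) q (pend m s ++ p)) s' B) :
    Runs Q .q translate (st t r c y (s :: w) z x g q (m :: p)) s' (B + 8) := by
  have e : Function.update (st t r c y (s :: w) z x g q (m :: p)) .w w =
      st t r c y w z x g q (m :: p) := by
    funext k; cases k <;> rfl
  refine (Runs.each_cons (a := s) (l := w) (by rfl) ?_ h).mono (by omega : 7 + B + 1 ≤ _)
  rw [e]
  exact runs_translateStep hs

theorem runs_translate_bits (l : List Bool) {t r c y w z x g q p : List Sym}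
    {s' : FixStack → List Sym} {B : ℕ}
    (h : Runs Q .q translate (st t r c y w (.close :: ((l.map Sym.bit).reverse ++ z)) x
      (.close :: ((l.map Sym.bit).reverse ++ g)) q p) s' B) :
    Runs Q .q translate (st t r c y (l.map Sym.bit ++ .close :: w) z x g q (.var :: p)) s'
      (B + 8 * (l.length + 1)) := by
  induction l generalizing z g with
  | nil => exact runs_translate_cons (by simp) h
  | cons b l ih =>
    refine (runs_translate_cons (by simp) (ih ?_)).mono ?_
    · simpa [emit] using h
    · simp; omega

/-- Translation of a single formula. -/
theorem runs_translate_formula (F : Fol3 At) {b : Bool} {t r c y w z x g q p : List Sym}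
    {s' : FixStack → List Sym} {B : ℕ}
    (h : Runs Q .q translate (st t r c y w ((encFol name encTV F).reverse ++ z) x
      ((encFol name encBool (F.approx b)).reverse ++ g) q p) s' B) :
    Runs Q .q translate (st t r c y (encFol name encTV F ++ w) z x g q (.bit b :: p)) s'
      (B + 8 * (encFol name encTV F).length) := by
  induction F generalizing b w z g p B with
  | const v =>
    refine runs_translate_cons (by cases v <;> simp [encTV]) ?_
    cases v <;> simpa [encFol, encTV, Fol.approx, encBool, emit, pend] using h
  | atom a =>
    have := runs_translate_cons (Q := Q) (m := .bit b) (s := .var) (by simp)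
      (runs_translate_bits (Q := Q) (name a) (by simpa [encFol, encAtom, Fol.approx, emit] using h))
    refine (?_ : Runs _ _ _ _ _ _).mono (?_ : B + 8 * ((name a).length + 1) + 8 ≤ _)
    · simpa [encFol, encAtom] using this
    · simp [encFol, encAtom]; omega
  | neg F ih =>
    have := runs_translate_cons (Q := Q) (m := .bit b) (s := .neg) (by simp)
      (ih (b := !b) (by simpa [encFol, Fol.approx, emit] using h))
    refine Runs.mono (by simpa [encFol] using this) ?_
    simp [encFol]; omega
  | and F G ihF ihG =>
    have := runs_translate_cons (Q := Q) (m := .bit b) (s := .and) (by simp)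
      (ihF (b := b) (ihG (b := b) (by simpa [encFol, Fol.approx, emit] using h)))
    refine Runs.mono (by simpa [encFol] using this) ?_
    simp [encFol]; omega
  | or F G ihF ihG =>
    have := runs_translate_cons (Q := Q) (m := .bit b) (s := .or) (by simp)
      (ihF (b := b) (ihG (b := b) (by simpa [encFol, Fol.approx, emit] using h)))
    refine Runs.mono (by simpa [encFol] using this) ?_
    simp [encFol]; omega
  | imp F G ihF ihG =>
    have := runs_translate_cons (Q := Q) (m := .bit b) (s := .imp) (by simp)
      (ihF (b := !b) (ihG (b := b) (by simpa [encFol, Fol.approx, emit] using h)))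
    refine Runs.mono (by simpa [encFol] using this) ?_
    simp [encFol]; omega

/-- Translation of a theory. -/
theorem runs_translate_theory (Y : List (Fol3 At)) {b : Bool} {t r c y w z x g q : List Sym}
    {s' : FixStack → List Sym} {B : ℕ}
    (h : Runs Q .q translate (st t r c y w ((encFol3Theory name Y).reverse ++ z) x
      (((Y.map (Fol.approx b)).flatMap fun G => encFol name encBool G ++ [.sep]).reverse ++ g) q
      [.bit b, .bit b]) s' B) :
    Runs Q .q translate (st t r c y (encFol3Theory name Y ++ w) z x g q [.bit b, .bit b]) s'
      (B + 8 * (encFol3Theory name Y).length) := by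
  induction Y generalizing z g with
  | nil => simpa [encFol3Theory] using h
  | cons F Y ih =>
    have := runs_translate_formula (Q := Q) name F (b := b) (p := [.bit b])
      (runs_translate_cons (m := .bit b) (s := .sep) (p := []) (by simp)
        (ih (by simpa [encFol3Theory, emit] using h)))
    refine Runs.mono (by simpa [encFol3Theory] using this) ?_
    simp [encFol3Theory]; omega

/-- The pending polarities run out exactly at the end of the sequent, which is how the program
recognizes this end without a marker. Whatever follows is only set aside on `x`. -/
theorem runs_translate_rest (w : List Sym) {t r c y z x g q : List Sym} :
    Runs Q .q translate (st t r c y w z x g q []) (st t r c y [] z (w.reverse ++ x) g q [])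
      (3 * w.length + 1) := by
  induction w generalizing x with
  | nil => exact Runs.each_nil rfl
  | cons s w ih =>
    refine ((Runs.each_cons (a := s) (l := w) (by rfl) ((Runs.pop Runs.push).of_eq ?_)
      (ih (x := s :: x))).mono ?_).of_eq (by simp)
    · funext k; cases k <;> rfl
    · simp; omega

/-- Translation of a sequent, followed by other symbols. -/
theorem runs_translate (Y : List (Fol3 At)) (G : Fol3 At) (b : Bool) (w : List Sym)
    {t r c y x q : List Sym} :
    Runs Q .q translate
      (st t r c y (encFol3Theory name Y ++ .turnstile :: (encFol name encTV G ++ w)) [] x [] q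
        [.bit b, .bit b])
      (st t r c y [] (encFol3Theory name Y ++ .turnstile :: encFol name encTV G).reverse
        (w.reverse ++ x)
        (encSequent name (Y.map (Fol.approx b)) (G.approx !b)).reverse q [])
      (8 * ((encFol3Theory name Y).length + (encFol name encTV G).length + w.length + 2)) := by
  have h₁ := runs_translate_formula (Q := Q) name G (b := !b) (w := w) (p := [])
    (z := .turnstile :: (encFol3Theory name Y).reverse)
    (g := .turnstile ::
      ((Y.map (Fol.approx b)).flatMap fun G => encFol name encBool G ++ [.sep]).reverse)
    (t := t) (r := r) (c := c) (y := y) (x := x) (q := q) (runs_translate_rest w)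
  have h₂ := Runs.each_cons (a := Sym.turnstile) (l := encFol name encTV G ++ w)
    (s := st t r c y (.turnstile :: (encFol name encTV G ++ w)) (encFol3Theory name Y).reverse x
      (((Y.map (Fol.approx b)).flatMap fun G => encFol name encBool G ++ [.sep]).reverse) q
      [.bit b, .bit b]) rfl
    (by
      have e : Function.update (st t r c y (.turnstile :: (encFol name encTV G ++ w))
          (encFol3Theory name Y).reverse x
          (((Y.map (Fol.approx b)).flatMap fun G => encFol name encBool G ++ [.sep]).reverse) q
          [.bit b, .bit b]) .w (encFol name encTV G ++ w) =
          st t r c y (encFol name encTV G ++ w) (encFol3Theory name Y).reverse x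
          (((Y.map (Fol.approx b)).flatMap fun G => encFol name encBool G ++ [.sep]).reverse) q
          [.bit b, .bit b] := by
        funext k; cases k <;> rfl
      rw [e]; exact runs_translateStep_turnstile) h₁
  have h₃ := runs_translate_theory (Q := Q) name Y (b := b) (z := []) (g := [])
    (by simpa using h₂)
  refine Runs.of_eq (h₃.mono ?_) ?_
  · omega
  · simp [encSequent]

theorem runs_finish (s : Sym) {t r c y z x : List Sym} :
    Runs Q .q (finish s) (st t r c y [] z x [] [] []) (st t r c y (s :: x.reverse) [] [] [] [] [])
      (2 * z.length + 2 * x.length + 4) := by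
  have h₁ : Runs Q .q (clear .z) (st t r c y [] z x [] [] []) (st t r c y [] [] x [] [] [])
      (2 * z.length + 1) :=
    (Runs.clear z rfl).of_eq (by funext k; cases k <;> rfl)
  have h₂ : Runs Q .q (move .x .w) (st t r c y [] [] x [] [] [])
      (st t r c y x.reverse [] [] [] [] []) (2 * x.length + 1) :=
    (Runs.move (by decide) x rfl).of_eq (by funext k; cases k <;> simp [st])
  refine ((h₁.cons (h₂.cons (Runs.push.cons Runs.nil))).of_eq ?_).mono (by omega)
  funext k; cases k <;> rfl

/-- Translation works symbol by symbol, which keeps the length of the queries under control. -/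
theorem length_encFol_approx (F : Fol3 At) (b : Bool) :
    (encFol name encBool (F.approx b)).length = (encFol name encTV F).length := by
  induction F generalizing b with
  | const v => cases v <;> simp [Fol.approx, encFol]
  | atom a => simp [Fol.approx, encFol]
  | neg F ih => simp [Fol.approx, encFol, ih]
  | and F G ihF ihG => simp [Fol.approx, encFol, ihF, ihG]
  | or F G ihF ihG => simp [Fol.approx, encFol, ihF, ihG]
  | imp F G ihF ihG => simp [Fol.approx, encFol, ihF, ihG]

theorem length_encSequent_approx (Y : List (Fol3 At)) (G : Fol3 At) (b b' : Bool) :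
    (encSequent name (Y.map (Fol.approx b)) (G.approx b')).length =
      (encFol3Theory name Y).length + (encFol name encTV G).length + 1 := by
  induction Y with
  | nil => simp [encSequent, encFol3Theory, length_encFol_approx]
  | cons F Y ih =>
    simp only [encSequent, encFol3Theory, List.map_cons, List.flatMap_cons, List.length_append,
      List.length_cons, length_encFol_approx] at ih ⊢
    omega

/-- One query: translate the sequent and move the translation to the query stack. -/
theorem runs_query (Y : List (Fol3 At)) (G : Fol3 At) (b : Bool) (w : List Sym)
    {ps : List (Prog FixStack Sym)} {t r c y x : List Sym} {s' : FixStack → List Sym} {B : ℕ}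
    (h : Runs Q .q (block ps)
      (st t r c y [] (encFol3Theory name Y ++ .turnstile :: encFol name encTV G).reverse (w.reverse ++ x)
        [] (encSequent name (Y.map (Fol.approx b)) (G.approx !b)) []) s' B) :
    Runs Q .q (block (pushes .p [.bit b, .bit b] :: translate :: move .g .q :: ps))
      (st t r c y (encFol3Theory name Y ++ .turnstile :: (encFol name encTV G ++ w))
        [] x [] [] []) s'
      (B + 10 * ((encFol3Theory name Y).length + (encFol name encTV G).length + w.length + 3)) := by
  have h₁ : Runs Q .q (pushes .p [.bit b, .bit b])
      (st t r c y (encFol3Theory name Y ++ .turnstile :: (encFol name encTV G ++ w)) [] x [] [] [])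
      (st t r c y (encFol3Theory name Y ++ .turnstile :: (encFol name encTV G ++ w)) [] x [] []
        [.bit b, .bit b]) 3 :=
    (Runs.pushes _).of_eq (by funext k; cases k <;> rfl)
  have h₂ : Runs Q .q (move .g .q)
      (st t r c y [] (encFol3Theory name Y ++ .turnstile :: encFol name encTV G).reverse (w.reverse ++ x)
        (encSequent name (Y.map (Fol.approx b)) (G.approx !b)).reverse [] [])
      (st t r c y [] (encFol3Theory name Y ++ .turnstile :: encFol name encTV G).reverse (w.reverse ++ x)
        [] (encSequent name (Y.map (Fol.approx b)) (G.approx !b)) [])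
      (2 * ((encFol3Theory name Y).length + (encFol name encTV G).length + 1) + 1) := by
    rw [← length_encSequent_approx name Y G b !b, ← List.length_reverse]
    exact (Runs.move (by decide) _ rfl).of_eq (by funext k; cases k <;> simp [st])
  refine (h₁.cons ((runs_translate name Y G b w).cons (h₂.cons h))).mono ?_
  omega

/-- At most two queries are needed. The first tests for `t`; on a negative answer the sequent saved
on `z` is restored and translated with the opposite polarities, which separates `u` from `f`. The
assumption on `Q` concerns well-formed sequents only, since no other word is asked. -/
theorem runs_evalBox (hQ : ∀ U F, encSequent name U F ∈ Q ↔ Prov {G | G ∈ U} F)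
    (Y : List (Fol3 At)) (G : Fol3 At) (w : List Sym) {t r c : List Sym} :
    Runs Q .q evalBox
      (st t r c (encFol3Theory name Y) (encFol name encTV G ++ w) [] [] [] [] [])
      (st t r c (encFol3Theory name Y) (encTV (valK {H | H ∈ Y} G) :: w) [] [] [] [] [])
      (40 * ((encFol3Theory name Y).length + (encFol name encTV G).length + w.length + 3)) := by
  set y := encFol3Theory name Y with hy
  have h₁ : Runs Q .q (.push .w .turnstile) (st t r c y (encFol name encTV G ++ w) [] [] [] [] [])
      (st t r c y (.turnstile :: (encFol name encTV G ++ w)) [] [] [] [] []) 1 :=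
    Runs.push.of_eq (by funext k; cases k <;> rfl)
  have h₂ : Runs Q .q (move .y .z)
      (st t r c y (.turnstile :: (encFol name encTV G ++ w)) [] [] [] [] [])
      (st t r c [] (.turnstile :: (encFol name encTV G ++ w)) y.reverse [] [] [] [])
      (2 * y.length + 1) :=
    (Runs.move (by decide) _ rfl).of_eq (by funext k; cases k <;> simp [st])
  have h₃ : Runs Q .q (moveBoth .z .y .w)
      (st t r c [] (.turnstile :: (encFol name encTV G ++ w)) y.reverse [] [] [] [])
      (st t r c y (y ++ .turnstile :: (encFol name encTV G ++ w)) [] [] [] [] [])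
      (3 * y.reverse.length + 1) :=
    (Runs.moveBoth (by decide) (by decide) (by decide) _ rfl).of_eq
      (by funext k; cases k <;> simp [st])
  have hset : ∀ b : Bool, {H | H ∈ Y.map (Fol.approx b)} = Fol.approx b '' {H | H ∈ Y} := by
    intro b; ext H; simp
  have hover : encSequent name (Y.map (Fol.approx true)) (G.approx !true) ∈ Q ↔
      Prov (Fol.over '' {H | H ∈ Y}) G.under := by
    rw [hQ, hset]; rfl
  have hunder : encSequent name (Y.map (Fol.approx false)) (G.approx !false) ∈ Q ↔
      Prov (Fol.under '' {H | H ∈ Y}) G.over := by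
    rw [hQ, hset]; rfl
  have hfin : ∀ s v, Runs Q .q (finish s)
      (Function.update (st t r c y [] (y ++ .turnstile :: encFol name encTV G).reverse w.reverse
        [] v []) .q [])
      (st t r c y (s :: w) [] [] [] [] [])
      (2 * (y ++ .turnstile :: encFol name encTV G).length + 2 * w.length + 4) := by
    intro s v
    have e : Function.update (st t r c y [] (y ++ .turnstile :: encFol name encTV G).reverse
        w.reverse [] v []) .q [] = st t r c y []
        (y ++ .turnstile :: encFol name encTV G).reverse w.reverse [] [] [] := by
      funext k; cases k <;> rfl
    rw [e]
    have h := runs_finish (Q := Q) s (t := t) (r := r) (c := c) (y := y)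
      (z := (y ++ .turnstile :: encFol name encTV G).reverse) (x := w.reverse)
    rwa [List.reverse_reverse, List.length_reverse, List.length_reverse] at h
  by_cases p₁ : Prov (Fol.over '' {H | H ∈ Y}) G.under
  · have h := runs_query name Y G true w (x := [])
      (Runs.cons (Runs.ask_yes (q := evalBoxUndef) (by exact hover.2 p₁)
        (by simpa only [List.append_nil] using hfin .tt _)) Runs.nil)
    have e : valK {H | H ∈ Y} G = .t := by simp only [valK, if_pos p₁]
    rw [e]
    refine (h₁.cons (h₂.cons (h₃.cons h))).mono ?_
    simp [← hy]; omega
  · have h₄ : Runs Q .q (move .z .w)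
        (Function.update (st t r c y [] (y ++ .turnstile :: encFol name encTV G).reverse w.reverse
          [] (encSequent name (Y.map (Fol.approx true)) (G.approx !true)) []) .q [])
        (st t r c y (y ++ .turnstile :: encFol name encTV G) [] w.reverse [] [] [])
        (2 * (y ++ .turnstile :: encFol name encTV G).reverse.length + 1) :=
      (Runs.move (by decide) _ rfl).of_eq (by funext k; cases k <;> simp [st])
    -- In the second translation nothing follows the sequent on `w`, because the remainder is still
    -- on `x`; the empty remainder is made explicit to fit `runs_query`.
    have hw : y ++ .turnstile :: encFol name encTV G =
        y ++ .turnstile :: (encFol name encTV G ++ []) := by simp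
    rw [hw] at h₄
    by_cases p₂ : Prov (Fol.under '' {H | H ∈ Y}) G.over
    · have h' := runs_query name Y G false [] (x := w.reverse)
        (Runs.cons (Runs.ask_yes (q := finish .ff) (by exact hunder.2 p₂) (hfin .uu _)) Runs.nil)
      have h := runs_query name Y G true w (x := [])
        (Runs.cons (Runs.ask_no (p := finish .tt) (q := evalBoxUndef) (by exact mt hover.1 p₁)
          (by simpa only [List.append_nil, evalBoxUndef] using h₄.cons h')) Runs.nil)
      have e : valK {H | H ∈ Y} G = .u := by simp [valK, p₁, p₂]
      rw [e]
      refine (h₁.cons (h₂.cons (h₃.cons h))).mono ?_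
      simp [← hy]; omega
    · have h' := runs_query name Y G false [] (x := w.reverse)
        (Runs.cons (Runs.ask_no (p := finish .uu) (by exact mt hunder.1 p₂) (hfin .ff _)) Runs.nil)
      have h := runs_query name Y G true w (x := [])
        (Runs.cons (Runs.ask_no (p := finish .tt) (q := evalBoxUndef) (by exact mt hover.1 p₁)
          (by simpa only [List.append_nil, evalBoxUndef] using h₄.cons h')) Runs.nil)
      have e : valK {H | H ∈ Y} G = .f := by simp [valK, p₁, p₂]
      rw [e]
      refine (h₁.cons (h₂.cons (h₃.cons h))).mono ?_
      simp [← hy]; omega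

/-- A modal literal shrinks to a single constant, so iterating the operator never produces anything
longer than the theory itself. -/
theorem length_encFol_inst_le (Y : Set (Fol3 At)) (F : Modal At) :
    (encFol name encTV (inst Y F)).length ≤ (encModal name F).length := by
  induction F with
  | atom a => simp [inst, encFol, encModal]
  | neg F ih => simpa [inst, encFol, encModal] using ih
  | and F G ihF ihG => simp [inst, encFol, encModal]; omega
  | or F G ihF ihG => simp [inst, encFol, encModal]; omega
  | imp F G ihF ihG => simp [inst, encFol, encModal]; omega
  | K F ih => simp [inst, encFol, encModal]

theorem length_encFol3Theory_inst_le (Y : Set (Fol3 At)) (T : List (Modal At)) :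
    (encFol3Theory name (T.map (inst Y))).length ≤ (encModalTheory name T).length := by
  induction T with
  | nil => simp [encFol3Theory, encModalTheory]
  | cons F T ih =>
    have := length_encFol_inst_le name Y F
    simp only [encFol3Theory, encModalTheory, List.map_cons, List.flatMap_cons,
      List.length_append] at ih ⊢
    omega

theorem runs_instTheory_cons {t r c y w : List Sym} {s : Sym} (hs : s ≠ .box)
    {s' : FixStack → List Sym} {B : ℕ}
    (h : Runs Q .q instTheory (st (s :: t) r c y (s :: w) [] [] [] [] []) s' B) :
    Runs Q .q instTheory (st t (s :: r) c y w [] [] [] [] []) s' (B + 3) := by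
  refine (Runs.each_cons (a := s) (l := r) (b := 2) (by rfl) ?_ h).mono (by omega)
  rw [instStep, if_neg hs]
  refine (Runs.push.seq Runs.push).of_eq ?_
  funext k; cases k <;> rfl

theorem runs_instTheory_atom (a : At) {t r c y w : List Sym}
    {s' : FixStack → List Sym} {B : ℕ}
    (h : Runs Q .q instTheory (st (encAtom name a ++ t) r c y (encAtom name a ++ w)
      [] [] [] [] []) s' B) :
    Runs Q .q instTheory (st t ((encAtom name a).reverse ++ r) c y w [] [] [] [] []) s'
      (B + 3 * (encAtom name a).length) := by
  have key : ∀ (l : List Sym) (t w : List Sym), (∀ s ∈ l, s ≠ .box) →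
      Runs Q .q instTheory (st (l.reverse ++ t) r c y (l.reverse ++ w) [] [] [] [] []) s' B →
      Runs Q .q instTheory (st t (l ++ r) c y w [] [] [] [] []) s' (B + 3 * l.length) := by
    intro l
    induction l with
    | nil => exact fun _ _ _ h => h
    | cons s l ih =>
      intro t w hl h
      refine (runs_instTheory_cons (hl s (by simp))
        (ih (s :: t) (s :: w) (fun s hs => hl s (by simp [hs])) (by simpa using h))).mono ?_
      simp; omega
  have := key (encAtom name a).reverse t w (by
    simp only [encAtom, List.mem_reverse, List.mem_cons, List.mem_append, List.mem_map]
    rintro s (rfl | ⟨_, _, rfl⟩ | rfl | h) <;> simp_all) (by simpa using h)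
  simpa using this

/-- Instantiation of a single formula. -/
theorem runs_instTheory_formula (hQ : ∀ U F, encSequent name U F ∈ Q ↔ Prov {G | G ∈ U} F)
    (Y : List (Fol3 At)) (F : Modal At) {n : ℕ} (hn : (encFol3Theory name Y).length ≤ n)
    {t r c w : List Sym} (hw : (encModal name F).length + w.length ≤ n)
    {s' : FixStack → List Sym} {B : ℕ}
    (h : Runs Q .q instTheory (st (encModal name F ++ t) r c (encFol3Theory name Y)
      (encFol name encTV (inst {G | G ∈ Y} F) ++ w) [] [] [] [] []) s' B) :
    Runs Q .q instTheory (st t ((encModal name F).reverse ++ r) c (encFol3Theory name Y) w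
      [] [] [] [] []) s' (B + (encModal name F).length * (80 * n + 130)) := by
  -- `C` is the price of one symbol. The dearest one is a box: `40 * (2 * n + 3)` steps for
  -- `evalBox`, since the two bounds add up to `2 * n`, and 2 more for the push and the loop.
  obtain ⟨C, hC⟩ : ∃ C, C = 80 * n + 130 := ⟨_, rfl⟩
  rw [← hC]
  induction F generalizing t r w B with
  | atom a =>
    refine (runs_instTheory_atom name a h).mono ?_
    simp only [encModal]
    rw [Nat.mul_comm 3]
    gcongr
    omega
  | neg F ih =>
    simp only [encModal, inst, encFol, List.reverse_cons, List.length_cons] at h hw ⊢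
    have := ih (r := .neg :: r) (t := t) (w := w) (by omega)
      (runs_instTheory_cons (by simp) (by simpa using h))
    refine Runs.mono (by simpa using this) ?_
    simp only [Nat.add_mul]; omega
  | and F G ihF ihG =>
    simp only [encModal, inst, encFol, List.reverse_cons, List.length_cons, List.reverse_append,
      List.length_append] at h hw ⊢
    -- The right operand is processed first. Its instance, now on `w`, is no longer than the
    -- operand, so the length bound is inherited by the left operand.
    have hG := length_encFol_inst_le name {G | G ∈ Y} G
    have := ihG (r := (encModal name F).reverse ++ .and :: r) (t := t) (w := w) (by omega)
      (ihF (r := .and :: r) (by simp; omega)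
        (runs_instTheory_cons (by simp) (by simpa using h)))
    refine Runs.mono (by simpa using this) ?_
    simp only [Nat.add_mul]; omega
  | or F G ihF ihG =>
    simp only [encModal, inst, encFol, List.reverse_cons, List.length_cons, List.reverse_append,
      List.length_append] at h hw ⊢
    have hG := length_encFol_inst_le name {G | G ∈ Y} G
    have := ihG (r := (encModal name F).reverse ++ .or :: r) (t := t) (w := w) (by omega)
      (ihF (r := .or :: r) (by simp; omega)
        (runs_instTheory_cons (by simp) (by simpa using h)))
    refine Runs.mono (by simpa using this) ?_
    simp only [Nat.add_mul]; omega
  | imp F G ihF ihG =>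
    simp only [encModal, inst, encFol, List.reverse_cons, List.length_cons, List.reverse_append,
      List.length_append] at h hw ⊢
    have hG := length_encFol_inst_le name {G | G ∈ Y} G
    have := ihG (r := (encModal name F).reverse ++ .imp :: r) (t := t) (w := w) (by omega)
      (ihF (r := .imp :: r) (by simp; omega)
        (runs_instTheory_cons (by simp) (by simpa using h)))
    refine Runs.mono (by simpa using this) ?_
    simp only [Nat.add_mul]; omega
  | K F ih =>
    simp only [encModal, inst, encFol, List.reverse_cons, List.length_cons] at h hw ⊢
    have hF := length_encFol_inst_le name {G | G ∈ Y} F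
    -- Since the word is read from right to left, the argument of the box is already instantiated
    -- and on top of `w`: nested literals are evaluated first.
    have hbox : Runs Q .q (instStep .box)
        (st (encModal name F ++ t) r c (encFol3Theory name Y)
          (encFol name encTV (inst {G | G ∈ Y} F) ++ w) [] [] [] [] [])
        (st (.box :: (encModal name F ++ t)) r c (encFol3Theory name Y)
          (encTV (valK {G | G ∈ Y} (inst {G | G ∈ Y} F)) :: w) [] [] [] [] [])
        (80 * n + 121) := by
      rw [instStep, if_pos rfl]
      have h₁ : Runs Q .q (.push .t .box) (st (encModal name F ++ t) r c (encFol3Theory name Y)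
          (encFol name encTV (inst {G | G ∈ Y} F) ++ w) [] [] [] [] [])
          (st (.box :: (encModal name F ++ t)) r c (encFol3Theory name Y)
          (encFol name encTV (inst {G | G ∈ Y} F) ++ w) [] [] [] [] []) 1 :=
        Runs.push.of_eq (by funext k; cases k <;> rfl)
      refine (h₁.seq (runs_evalBox name hQ Y _ w)).mono ?_
      omega
    have := ih (r := .box :: r) (t := t) (w := w) (by omega)
      (Runs.each_cons (a := Sym.box) (l := r) (by rfl) (hbox.of_eq_left (by funext k; cases k <;> rfl)) h)
    refine Runs.mono (by simpa using this) ?_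
    simp only [Nat.add_mul]; omega

theorem runs_instTheory (hQ : ∀ U F, encSequent name U F ∈ Q ↔ Prov {G | G ∈ U} F)
    (Y : List (Fol3 At)) (T : List (Modal At)) {n : ℕ} (hn : (encFol3Theory name Y).length ≤ n)
    (hT : (encModalTheory name T).length ≤ n) {c : List Sym} :
    Runs Q .q instTheory
      (st [] (encModalTheory name T).reverse c (encFol3Theory name Y) [] [] [] [] [] [])
      (st (encModalTheory name T) [] c (encFol3Theory name Y)
        (encFol3Theory name (T.map (inst {G | G ∈ Y}))) [] [] [] [] [])
      ((encModalTheory name T).length * (80 * n + 130) + 1) := by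
  -- Generalization to a theory of which `T₂` has been processed and `T₁` has not; the induction
  -- removes the last formula of `T₁`, in accordance with the direction of reading.
  have key : ∀ (T₁ T₂ : List (Modal At)),
      (encModalTheory name T₁).length + (encModalTheory name T₂).length ≤ n →
      Runs Q .q instTheory
        (st (encModalTheory name T₂) (encModalTheory name T₁).reverse c (encFol3Theory name Y)
          (encFol3Theory name (T₂.map (inst {G | G ∈ Y}))) [] [] [] [] [])
        (st (encModalTheory name (T₁ ++ T₂)) [] c (encFol3Theory name Y)
          (encFol3Theory name ((T₁ ++ T₂).map (inst {G | G ∈ Y}))) [] [] [] [] [])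
        ((encModalTheory name T₁).length * (80 * n + 130) + 1) := by
    intro T₁
    induction T₁ using List.reverseRecOn with
    | nil => intro T₂ _; exact (Runs.each_nil rfl).mono (by simp)
    | append_singleton T₁ F ih =>
      intro T₂ hlen
      have e : encModalTheory name (T₁ ++ [F]) =
          encModalTheory name T₁ ++ (encModal name F ++ [.sep]) := by simp [encModalTheory]
      have e₂ : encModalTheory name (F :: T₂) =
          encModal name F ++ .sep :: encModalTheory name T₂ := by simp [encModalTheory]
      have e₃ : ∀ (G : Fol3 At) L, encFol3Theory name (G :: L) =
          encFol name encTV G ++ .sep :: encFol3Theory name L := by simp [encFol3Theory]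
      have hl := length_encFol3Theory_inst_le name {G | G ∈ Y} T₂
      rw [e] at hlen ⊢
      simp only [List.length_append, List.length_cons, List.length_nil] at hlen
      have h := ih (F :: T₂) (by rw [e₂]; simp; omega)
      have h' := runs_instTheory_cons (Q := Q) (s := .sep) (by simp)
        (runs_instTheory_formula name hQ Y F hn (r := (encModalTheory name T₁).reverse)
          (t := .sep :: encModalTheory name T₂)
          (w := .sep :: encFol3Theory name (T₂.map (inst {G | G ∈ Y}))) (by simp; omega)
          (by rw [e₂, List.map_cons, e₃] at h; simpa using h))
      refine Runs.mono (by simpa using h') ?_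
      simp only [List.length_append, List.length_cons, List.length_nil, Nat.add_mul]
      omega
  have := key T [] (by simpa [encModalTheory] using hT)
  simpa [encModalTheory, encFol3Theory] using this

/-! ### The main loop and the total running time. -/

theorem runs_iterate (hQ : ∀ U F, encSequent name U F ∈ Q ↔ Prov {G | G ∈ U} F)
    (Y : List (Fol3 At)) (T : List (Modal At)) {n : ℕ} (hn : (encFol3Theory name Y).length ≤ n)
    (hT : (encModalTheory name T).length ≤ n) {c : List Sym} :
    Runs Q .q iterate
      (st [] (encModalTheory name T).reverse c (encFol3Theory name Y) [] [] [] [] [] [])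
      (st [] (encModalTheory name T).reverse c (encFol3Theory name (T.map (inst {G | G ∈ Y})))
        [] [] [] [] [] [])
      (n * (80 * n + 130) + 8 * n + 6) := by
  have hl := length_encFol3Theory_inst_le name {G | G ∈ Y} T
  have h₁ := runs_instTheory name hQ Y T hn hT (c := c)
  set e := encModalTheory name T
  set y := encFol3Theory name Y
  set y' := encFol3Theory name (T.map (inst {G | G ∈ Y})) with hy'
  have h₂ : Runs Q .q (clear .y) (st e [] c y y' [] [] [] [] []) (st e [] c [] y' [] [] [] [] [])
      (2 * y.length + 1) :=
    (Runs.clear y (by rfl)).of_eq (by funext k; cases k <;> rfl)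
  have h₃ : Runs Q .q (move .w .z) (st e [] c [] y' [] [] [] [] [])
      (st e [] c [] [] y'.reverse [] [] [] []) (2 * y'.length + 1) :=
    (Runs.move (by decide) _ rfl).of_eq (by funext k; cases k <;> simp [st])
  have h₄ : Runs Q .q (move .z .y) (st e [] c [] [] y'.reverse [] [] [] [])
      (st e [] c y' [] [] [] [] [] []) (2 * y'.reverse.length + 1) :=
    (Runs.move (by decide) _ rfl).of_eq (by funext k; cases k <;> simp [st])
  have h₅ : Runs Q .q (move .t .r) (st e [] c y' [] [] [] [] [] [])
      (st [] e.reverse c y' [] [] [] [] [] []) (2 * e.length + 1) :=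
    (Runs.move (by decide) _ rfl).of_eq (by funext k; cases k <;> simp [st])
  refine (h₁.cons (h₂.cons (h₃.cons (h₄.cons (h₅.cons Runs.nil))))).mono ?_
  rw [List.length_reverse]
  have : e.length * (80 * n + 130) ≤ n * (80 * n + 130) := Nat.mul_le_mul_right _ hT
  omega

/-- The 3-FOL theory that the fixpoint program computes. -/
noncomputable def fixTheory (T : List (Modal At)) (j : ℕ) : List (Fol3 At) :=
  (fun Y => T.map (inst {G | G ∈ Y}))^[j] [.const .u]

theorem fixTheory_succ (T : List (Modal At)) (j : ℕ) :
    fixTheory T (j + 1) = T.map (inst {G | G ∈ fixTheory T j}) :=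
  Function.iterate_succ_apply' _ _ _

/-- The program works with lists and may repeat formulas; this is harmless because instantiation
depends only on the set of members. -/
theorem setOf_fixTheory (T : List (Modal At)) (j : ℕ) :
    {G | G ∈ fixTheory T j} = stage {F | F ∈ T} j := by
  induction j with
  | zero => ext G; simp [fixTheory, stage]
  | succ j ih =>
    rw [fixTheory_succ, stage_succ, ← ih]
    ext G; simp [SD]

/-- The summand 2 covers the initial theory, written with the two symbols `uu` and `sep`; all later
theories are instances of `T`. -/
theorem length_fixTheory_le (T : List (Modal At)) (j : ℕ) :
    (encFol3Theory name (fixTheory T j)).length ≤ (encModalTheory name T).length + 2 := by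
  cases j with
  | zero => simp [fixTheory, encFol3Theory, encFol]
  | succ j =>
    rw [fixTheory_succ]
    have := length_encFol3Theory_inst_le name {G | G ∈ fixTheory T j} T
    omega

theorem runs_each_iterate (hQ : ∀ U F, encSequent name U F ∈ Q ↔ Prov {G | G ∈ U} F)
    (T : List (Modal At)) {n : ℕ} (hT : (encModalTheory name T).length + 2 ≤ n) (c : List Sym)
    (j : ℕ) :
    Runs Q .q (.each .c fun _ => iterate)
      (st [] (encModalTheory name T).reverse c (encFol3Theory name (fixTheory T j))
        [] [] [] [] [] [])
      (st [] (encModalTheory name T).reverse [] (encFol3Theory name (fixTheory T (j + c.length)))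
        [] [] [] [] [] [])
      (c.length * (n * (80 * n + 130) + 8 * n + 7) + 1) := by
  induction c generalizing j with
  | nil => exact (Runs.each_nil rfl).mono (by simp)
  | cons s c ih =>
    have h := ih (j + 1)
    have hl := length_fixTheory_le name T j
    have h' := runs_iterate name hQ (fixTheory T j) T (n := n) (by omega) (by omega) (c := c)
    rw [← fixTheory_succ] at h'
    rw [List.length_cons, Nat.add_mul, show j + (c.length + 1) = j + 1 + c.length by omega]
    refine (Runs.each_cons (a := s) (l := c) (by rfl) (h'.of_eq_left ?_) h).mono ?_
    · funext k; cases k <;> rfl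
    · omega

theorem runs_fixProg (hQ : ∀ U F, encSequent name U F ∈ Q ↔ Prov {G | G ∈ U} F)
    (T : List (Modal At)) {n : ℕ} (hn : (encModalTheory name T).length + 2 = n) :
    ∃ s, Runs Q .q fixProg (Function.update (fun _ => []) .t (encModalTheory name T)) s
        (n * (n * (80 * n + 130) + 8 * n + 7) + 3 * n + 10) ∧
      s .y = encFol3Theory name (fixTheory T ((encModalTheory name T).length + 1)) := by
  -- One pass over the input yields both the reversed theory and a counter of the same length. The
  -- additional `sep` makes it `|T| + 1` rounds, since the fixpoint is guaranteed only at some stage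
  -- `k + 1` with `k ≤ |T|`.
  have h := runs_each_iterate name hQ T hn.le (.sep :: (encModalTheory name T).reverse) 0
  have e : 0 + (Sym.sep :: (encModalTheory name T).reverse).length =
      (encModalTheory name T).length + 1 := by simp
  rw [e] at h
  refine ⟨_, Runs.mono (Runs.cons (Runs.moveBoth (by decide) (by decide) (by decide)
    (encModalTheory name T) (by rfl)) (Runs.cons Runs.push (Runs.cons (Runs.pushes _)
      (Runs.cons (h.of_eq_left ?_) Runs.nil)))) ?_, by rfl⟩
  · funext k
    cases k <;> simp [st, encFol3Theory, fixTheory, encFol, encTV]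
  · have : (Sym.sep :: (encModalTheory name T).reverse).length *
        (n * (80 * n + 130) + 8 * n + 7) ≤ n * (n * (80 * n + 130) + 8 * n + 7) :=
      Nat.mul_le_mul_right _ (by simp; omega)
    simp only [List.length_cons, List.length_nil] at this ⊢
    omega

end Correctness

end FixStack

/-! ### A nondeterministic procedure for unprovability -/

/-- The stacks of the verifier: input (`i`), certificate (`w`), current word (`x`), reversed next
word (`o`), mode (`m`), name buffer (`n`), the name to be replaced (`k`, `k'`), an auxiliary stack
(`a`), a flag (`f`) and values (`v`). -/
inductive VerStack
  | i | w | x | o | m | n | k | k' | a | f | v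
  deriving DecidableEq

instance : Fintype VerStack :=
  ⟨{.i, .w, .x, .o, .m, .n, .k, .k', .a, .f, .v}, fun s => by cases s <;> decide⟩

namespace Verifier

open Prog

/-- The alphabet of the verifier. -/
abbrev VSym : Type := Sym ⊕ Bool

/-- The stacks with the given contents. -/
def st (i w x o m n k k' a f v : List VSym) : VerStack → List VSym
  | .i => i
  | .w => w
  | .x => x
  | .o => o
  | .m => m
  | .n => n
  | .k => k
  | .k' => k'
  | .a => a
  | .f => f
  | .v => v

/-- Compare the words on `n` and `k`, move them reversed to `a` and `k'`, and write to `f` if they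
differ. -/
def compare : Prog VerStack VSym :=
  .seq (.each .n fun s => .seq (.push .a s) (.pop .k fun o => match o with
      | none => .push .f s
      | some t => .seq (.push .k' t) (if t = s then .skip else .push .f s)))
    (moveBoth .k .k' .f)

/-- The end of the name of an atom, which is replaced by the constant `c` if it is the name on `k`;
the first name is stored on `k`. -/
def closeName (c : VSym) : Prog VerStack VSym :=
  block [.push .n (.inl .close),
    .pop .k fun o => match o with
      | none => .seq (move .n .a) (moveBoth .a .n .k)
      | some t => .push .k t,
    compare, move .k' .k,
    .pop .f fun o => match o with
      | none => .seq (clear .a) (.push .o c)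
      | some _ => block [clear .f, .push .o (.inl .var), move .a .o]]

/-- One step of the replacement of the first atom by the constant `c`. -/
def passStep (c s : VSym) : Prog VerStack VSym :=
  .pop .m fun o => match o with
    | none => if s = .inl .var then .push .m s else .push .o s
    | some _ => if s = .inl .close then closeName c
        else .seq (.push .n s) (.push .m (.inl .var))

/-- The constant for a certificate symbol. -/
def bitConst : VSym → VSym
  | .inl s => .inl s
  | .inr b => .inl (encBool b)

/-- Replace the first atom of the word on `x` by a constant. -/
def pass (b : VSym) : Prog VerStack VSym :=
  block [.each .x (passStep (bitConst b)), clear .m, clear .n, clear .k, move .o .x]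

/-- The truth value on top of a stack. -/
def topVal : Option VSym → Bool
  | some (.inr b) => b
  | _ => false

/-- One step of the evaluation, from right to left, of formulas in Polish notation; atoms are
false. -/
def evalStep : VSym → Prog VerStack VSym
  | .inl .close => .push .v (.inr false)
  | .inl .ff => .push .v (.inr false)
  | .inl .tt => .push .v (.inr true)
  | .inl .neg => .pop .v fun o => .push .v (.inr !(topVal o))
  | .inl .turnstile => .pop .v fun o => .push .v (.inr !(topVal o))
  | .inl .and => .pop .v fun o => .pop .v fun o' => .push .v (.inr (topVal o && topVal o'))
  | .inl .or => .pop .v fun o => .pop .v fun o' => .push .v (.inr (topVal o || topVal o'))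
  | .inl .imp => .pop .v fun o => .pop .v fun o' => .push .v (.inr (!(topVal o) || topVal o'))
  | _ => .skip

/-- One step of the separation of the word from the certificate. -/
def splitStep : VSym → Prog VerStack VSym
  | .inl s => .push .o (.inl s)
  | .inr b => .push .w (.inr b)

/-- The verifier. -/
def verProg : Prog VerStack VSym :=
  block [.each .i splitStep,
    move .o .x, .each .w pass, move .x .o, .each .o evalStep,
    .each .v fun b => if b = .inr true then .skip else .push .f b,
    .pop .f fun o => match o with
      | none => .push .v (.inr true)
      | some _ => .push .v (.inr false)]

/-- The word, reversed, that `passStep` writes to `o`; the mode `some n` means that the name of an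
atom with reversed prefix `n` has been read. -/
def passOut (c : VSym) : List VSym → Option (List VSym) → List VSym → List VSym → List VSym
  | [], _, _, o => o
  | s :: x, none, k, o =>
      if s = .inl .var then passOut c x (some []) k o else passOut c x none k (s :: o)
  | s :: x, some n, k, o =>
      if s = .inl .close then
        let k₁ := if k = [] then s :: n else k
        if s :: n = k₁ then passOut c x none k₁ (c :: o)
        else passOut c x none k₁ (s :: n ++ .inl .var :: o)
      else passOut c x (some (s :: n)) k o

/-- The effect of `evalStep` on the values. -/
def valStep : VSym → List Bool → List Bool
  | .inl .close, v => false :: v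
  | .inl .ff, v => false :: v
  | .inl .tt, v => true :: v
  | .inl .neg, v => (!(v.headD false)) :: v.tail
  | .inl .turnstile, v => (!(v.headD false)) :: v.tail
  | .inl .and, v => (v.headD false && v.tail.headD false) :: v.tail.tail
  | .inl .or, v => (v.headD false || v.tail.headD false) :: v.tail.tail
  | .inl .imp, v => (!(v.headD false) || v.tail.headD false) :: v.tail.tail
  | _, v => v

/-- Replace the first atom of a word by the constant `b`. -/
def passWord (b : VSym) (x : List VSym) : List VSym := (passOut (bitConst b) x none [] []).reverse

/-- The word whose first atoms are replaced by the constants in `w`, starting from the last one. -/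
def passWords (w : List VSym) (x : List VSym) : List VSym := w.foldr passWord x

/-- The relation that the verifier decides. -/
def accepts (xw : List Sym × List Bool) : Bool :=
  ((passWords (xw.2.map .inr) (xw.1.map .inl)).foldr valStep []).all id

/-! ### Running time of the verifier on arbitrary words. -/

section Correctness

variable {Q : Set (List VSym)} {kq : VerStack}

/-- A pass never lengthens the word, so one bound serves for all passes. In the mode `some n` the
summand 1 stands for the symbol `var`, which has been read but not yet written back. -/
theorem length_passOut (c : VSym) (x k o : List VSym) :
    (passOut c x none k o).length ≤ x.length + o.length ∧
      ∀ n, (passOut c x (some n) k o).length ≤ x.length + n.length + 1 + o.length := by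
  induction x generalizing k o with
  | nil => simp [passOut]
  | cons s x ih =>
    constructor
    · simp only [passOut]
      split_ifs
      · have := (ih k o).2 []
        simp at this ⊢; omega
      · have := (ih k (s :: o)).1
        simp at this ⊢; omega
    · intro n
      simp only [passOut]
      split_ifs
      all_goals first
        | have := (ih (s :: n) (c :: o)).1
          simp at this ⊢; omega
        | have := (ih k (c :: o)).1
          simp at this ⊢; omega
        | have := (ih k (s :: n ++ .inl .var :: o)).1
          simp at this ⊢; omega
        | have := (ih k o).2 (s :: n)
          simp at this ⊢; omega
        | simp_all

theorem length_passWord (b : VSym) (x : List VSym) : (passWord b x).length ≤ x.length := by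
  have := (length_passOut (bitConst b) x [] []).1
  simpa [passWord] using this

/-- The first loop of `compare`. -/
theorem runs_compare_each (l : List VSym) {i w x o m k k' a f v : List VSym} :
    ∃ f', f'.length ≤ f.length + l.length ∧ (f' = [] ↔ f = [] ∧ l = k.take l.length) ∧
      Runs Q kq (.each .n fun s => .seq (.push .a s) (.pop .k fun o => match o with
        | none => .push .f s
        | some t => .seq (.push .k' t) (if t = s then .skip else .push .f s)))
        (st i w x o m l k k' a f v)
        (st i w x o m [] (k.drop l.length) ((k.take l.length).reverse ++ k') (l.reverse ++ a) f' v)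
        (5 * l.length + 1) := by
  induction l generalizing k k' a f with
  | nil => exact ⟨f, by simp, by simp, Runs.each_nil rfl⟩
  | cons s l ih =>
    cases k with
    | nil =>
      obtain ⟨f', h₁, h₂, h₃⟩ := ih (k := []) (k' := k') (a := s :: a) (f := s :: f)
      refine ⟨f', by simp at h₁ ⊢; omega, by simp at h₂ ⊢; exact h₂, ?_⟩
      refine ((Runs.each_cons (a := s) (l := l) (by rfl)
        ((Runs.push.seq (Runs.pop Runs.push)).of_eq ?_) h₃).of_eq ?_).mono ?_
      · funext j; cases j <;> rfl
      · simp
      · simp; omega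
    | cons t k =>
      by_cases e : t = s
      · subst e
        obtain ⟨f', h₁, h₂, h₃⟩ := ih (k := k) (k' := t :: k') (a := t :: a) (f := f)
        refine ⟨f', by simp at h₁ ⊢; omega, by simpa using h₂, ?_⟩
        have hb : Runs Q kq (.seq (.push .k' t) (if t = t then .skip else .push .f t))
            (st i w x o m l k k' (t :: a) f v) (st i w x o m l k (t :: k') (t :: a) f v) 2 := by
          rw [if_pos rfl]
          refine (Runs.push.seq Runs.skip).of_eq ?_
          funext j; cases j <;> rfl
        refine ((Runs.each_cons (a := t) (l := l) (by rfl)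
          (Runs.push.seq (Runs.pop (hb.of_eq_left ?_))) h₃).of_eq ?_).mono ?_
        · funext j; cases j <;> rfl
        · simp
        · simp; omega
      · obtain ⟨f', h₁, h₂, h₃⟩ := ih (k := k) (k' := t :: k') (a := s :: a) (f := s :: f)
        refine ⟨f', by simp at h₁ ⊢; omega, ?_, ?_⟩
        · simp only [reduceCtorEq, false_and, iff_false] at h₂
          simp [h₂, Ne.symm e]
        have hb : Runs Q kq (.seq (.push .k' t) (if t = s then .skip else .push .f s))
            (st i w x o m l k k' (s :: a) f v) (st i w x o m l k (t :: k') (s :: a) (s :: f) v)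
            2 := by
          rw [if_neg e]
          refine (Runs.push.seq Runs.push).of_eq ?_
          funext j; cases j <;> rfl
        refine ((Runs.each_cons (a := s) (l := l) (by rfl)
          (Runs.push.seq (Runs.pop (hb.of_eq_left ?_))) h₃).of_eq ?_).mono ?_
        · funext j; cases j <;> rfl
        · simp
        · simp; omega

/-- A mark on `f` arises from any mismatch, from symbols of `l` beyond the end of `k`, and, in the
final move, from symbols of `k` beyond the end of `l`. So `f` stays empty only for equal words. -/
theorem runs_compare (l k : List VSym) {i w x o m v : List VSym} :
    ∃ f, f.length ≤ l.length + k.length ∧ (f = [] ↔ l = k) ∧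
      Runs Q kq compare (st i w x o m l k [] [] [] v)
        (st i w x o m [] [] k.reverse l.reverse f v) (5 * l.length + 3 * k.length + 2) := by
  obtain ⟨f, h₁, h₂, h₃⟩ := runs_compare_each (Q := Q) (kq := kq) l (i := i) (w := w) (x := x)
    (o := o) (m := m) (k := k) (k' := []) (a := []) (f := []) (v := v)
  refine ⟨(k.drop l.length).reverse ++ f, by simp at h₁ ⊢; omega, ?_, ?_⟩
  · rw [List.append_eq_nil_iff, h₂, List.reverse_eq_nil_iff]
    constructor
    · rintro ⟨h, -, h'⟩
      rw [← List.take_append_drop l.length k, h, ← h']; simp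
    · rintro rfl; simp
  · refine ((h₃.seq (Runs.moveBoth (by decide) (by decide) (by decide) (k.drop l.length)
      (by rfl))).of_eq ?_).mono ?_
    · funext j
      cases j <;> simp [st]
      rw [← List.reverse_append, List.take_append_drop]
    · simp; omega

/-- An empty `k` unambiguously means that no name has been stored: a stored name includes `close`,
hence is nonempty even if the atom is named by the empty word. -/
theorem runs_closeName (c : VSym) (n k : List VSym) {i w x o v : List VSym} {B : ℕ}
    (hn : n.length + 1 ≤ B) (hk : k.length ≤ B) {l k₁ : List VSym} (hl : l = .inl .close :: n)
    (hk₁ : k₁ = if k = [] then l else k) :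
    Runs Q kq (closeName c) (st i w x o [] n k [] [] [] v)
      (st i w x (if l = k₁ then c :: o else l ++ .inl .var :: o) [] [] k₁ [] [] [] v)
      (30 * B + 30) := by
  have hlB : l.length ≤ B := by simpa [hl] using hn
  have hk₁B : k₁.length ≤ B := by rw [hk₁]; split_ifs <;> assumption
  have h₁ : Runs Q kq (.push .n (.inl .close)) (st i w x o [] n k [] [] [] v)
      (st i w x o [] l k [] [] [] v) 1 :=
    Runs.push.of_eq (by funext j; cases j <;> simp [st, hl])
  have h₂ : Runs Q kq (.pop .k fun o => match o with
      | none => .seq (move .n .a) (moveBoth .a .n .k)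
      | some t => .push .k t) (st i w x o [] l k [] [] [] v)
      (st i w x o [] l k₁ [] [] [] v) (5 * B + 3) := by
    cases k with
    | nil =>
      simp only [if_true] at hk₁
      subst hk₁
      refine ((Runs.pop ((Runs.move (by decide) k₁ (by rfl)).seq (Runs.moveBoth (by decide)
        (by decide) (by decide) (k₁.reverse) (by simp [st])))).of_eq ?_).mono ?_
      · funext j; cases j <;> simp [st]
      · simp; omega
    | cons t k =>
      simp only [reduceCtorEq, if_false] at hk₁
      subst hk₁
      refine ((Runs.pop Runs.push).of_eq ?_).mono ?_
      · funext j; cases j <;> rfl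
      · omega
  obtain ⟨f, hf, hf', h₃⟩ := runs_compare (Q := Q) (kq := kq) l k₁ (i := i) (w := w) (x := x)
    (o := o) (m := []) (v := v)
  have h₄ : Runs Q kq (move .k' .k) (st i w x o [] [] [] k₁.reverse l.reverse f v)
      (st i w x o [] [] k₁ [] l.reverse f v) (2 * B + 1) := by
    refine ((Runs.move (by decide) k₁.reverse (by rfl)).of_eq ?_).mono ?_
    · funext j; cases j <;> simp [st]
    · simpa using hk₁B
  have h₅ : Runs Q kq (.pop .f fun o => match o with
      | none => .seq (clear .a) (.push .o c)
      | some _ => block [clear .f, .push .o (.inl .var), move .a .o])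
      (st i w x o [] [] k₁ [] l.reverse f v)
      (st i w x (if l = k₁ then c :: o else l ++ .inl .var :: o) [] [] k₁ [] [] [] v)
      (6 * B + 10) := by
    cases f with
    | nil =>
      rw [if_pos (hf'.1 rfl)]
      refine ((Runs.pop ((Runs.clear l.reverse (by rfl)).seq Runs.push)).of_eq ?_).mono ?_
      · funext j; cases j <;> rfl
      · simp; omega
    | cons s f =>
      rw [if_neg fun h => by simpa using hf'.2 h]
      refine ((Runs.pop (Runs.cons (Runs.clear f (by rfl)) (Runs.cons Runs.push (Runs.cons
        (Runs.move (by decide) l.reverse (by rfl)) Runs.nil)))).of_eq ?_).mono ?_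
      · funext j; cases j <;> simp [st]
      · simp at hf ⊢; omega
  refine (h₁.cons (h₂.cons (h₃.cons (h₄.cons (h₅.cons Runs.nil))))).mono ?_
  omega

/-- The two modes are treated by one simultaneous induction. What remains on `m`, `n` and `k` is
only bounded, because the time bound must hold for malformed words too, and those may end inside a
name. -/
theorem runs_each_passStep (c : VSym) {B : ℕ} {i w v : List VSym} (x : List VSym) :
    (∀ k o, x.length ≤ B → k.length ≤ B → ∃ m n k',
      m.length ≤ 1 ∧ n.length ≤ B ∧ k'.length ≤ B ∧
      Runs Q kq (.each .x (passStep c)) (st i w x o [] [] k [] [] [] v)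
        (st i w [] (passOut c x none k o) m n k' [] [] [] v)
        (x.length * (30 * B + 35) + 1)) ∧
    (∀ n k o, x.length + n.length + 1 ≤ B → k.length ≤ B → ∃ m n' k',
      m.length ≤ 1 ∧ n'.length ≤ B ∧ k'.length ≤ B ∧
      Runs Q kq (.each .x (passStep c)) (st i w x o [.inl .var] n k [] [] [] v)
        (st i w [] (passOut c x (some n) k o) m n' k' [] [] [] v)
        (x.length * (30 * B + 35) + 1)) := by
  induction x with
  | nil =>
    refine ⟨fun k o _ hk => ⟨[], [], k, by simp, by simp, hk, (Runs.each_nil rfl).mono (by simp)⟩,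
      fun n k o hn hk => ⟨[.inl .var], n, k, by simp, by simp at hn; omega, hk,
        (Runs.each_nil rfl).mono (by simp)⟩⟩
  | cons s x ih =>
    constructor
    · intro k o hx hk
      simp only [List.length_cons] at hx
      by_cases hs : s = .inl .var
      · obtain ⟨m, n, k', hm, hn, hk', h⟩ := ih.2 [] k o (by simp; omega) hk
        refine ⟨m, n, k', hm, hn, hk', ?_⟩
        simp only [passOut, if_pos hs]
        have hb : Runs Q kq (if s = .inl .var then .push .m s else .push .o s)
            (st i w x o [] [] k [] [] [] v) (st i w x o [.inl .var] [] k [] [] [] v) 1 := by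
          rw [if_pos hs, hs]
          exact Runs.push.of_eq (by funext j; cases j <;> rfl)
        refine (Runs.each_cons (a := s) (l := x) (by rfl) (Runs.pop (hb.of_eq_left ?_)) h).mono ?_
        · funext j; cases j <;> rfl
        · simp only [List.length_cons, Nat.add_mul]; omega
      · obtain ⟨m, n, k', hm, hn, hk', h⟩ := ih.1 k (s :: o) (by omega) hk
        refine ⟨m, n, k', hm, hn, hk', ?_⟩
        simp only [passOut, if_neg hs]
        have hb : Runs Q kq (if s = .inl .var then .push .m s else .push .o s)
            (st i w x o [] [] k [] [] [] v) (st i w x (s :: o) [] [] k [] [] [] v) 1 := by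
          rw [if_neg hs]
          exact Runs.push.of_eq (by funext j; cases j <;> rfl)
        refine (Runs.each_cons (a := s) (l := x) (by rfl) (Runs.pop (hb.of_eq_left ?_)) h).mono ?_
        · funext j; cases j <;> rfl
        · simp only [List.length_cons, Nat.add_mul]; omega
    · intro n k o hx hk
      simp only [List.length_cons] at hx
      by_cases hs : s = .inl .close
      · obtain ⟨k₁, hk₁⟩ : ∃ k₁, k₁ = if k = [] then s :: n else k := ⟨_, rfl⟩
        have hc := runs_closeName (Q := Q) (kq := kq) c n k (i := i) (w := w) (x := x) (o := o)
          (v := v) (B := B) (by omega) hk (l := s :: n) (by rw [hs]) hk₁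
        obtain ⟨m, n', k', hm, hn, hk', h⟩ := ih.1 k₁
          (if s :: n = k₁ then c :: o else s :: n ++ .inl .var :: o) (by omega)
          (by rw [hk₁]; split_ifs <;> [(simp; omega); exact hk])
        refine ⟨m, n', k', hm, hn, hk', ?_⟩
        have e : passOut c (s :: x) (some n) k o = passOut c x none k₁
            (if s :: n = k₁ then c :: o else s :: n ++ .inl .var :: o) := by
          simp only [passOut, if_pos hs, ← hk₁]
          split_ifs <;> rfl
        rw [e]
        have hb : Runs Q kq (if s = .inl .close then closeName c
            else .seq (.push .n s) (.push .m (.inl .var))) (st i w x o [] n k [] [] [] v)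
            (st i w x (if s :: n = k₁ then c :: o else s :: n ++ .inl .var :: o) [] [] k₁ [] [] [] v)
            (30 * B + 30) := by
          rw [if_pos hs]
          exact hc
        refine (Runs.each_cons (a := s) (l := x) (by rfl) (Runs.pop (hb.of_eq_left ?_)) h).mono ?_
        · funext j; cases j <;> rfl
        · simp only [List.length_cons, Nat.add_mul]; omega
      · obtain ⟨m, n', k', hm, hn, hk', h⟩ := ih.2 (s :: n) k o (by simp; omega) hk
        refine ⟨m, n', k', hm, hn, hk', ?_⟩
        simp only [passOut, if_neg hs]
        have hb : Runs Q kq (if s = .inl .close then closeName c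
            else .seq (.push .n s) (.push .m (.inl .var))) (st i w x o [] n k [] [] [] v)
            (st i w x o [.inl .var] (s :: n) k [] [] [] v) 2 := by
          rw [if_neg hs]
          exact (Runs.push.seq Runs.push).of_eq (by funext j; cases j <;> rfl)
        refine (Runs.each_cons (a := s) (l := x) (by rfl) (Runs.pop (hb.of_eq_left ?_)) h).mono ?_
        · funext j; cases j <;> rfl
        · simp only [List.length_cons, Nat.add_mul]; omega

theorem runs_pass (b : VSym) {B : ℕ} {i w v x : List VSym} (hx : x.length ≤ B) :
    Runs Q kq (pass b) (st i w x [] [] [] [] [] [] [] v)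
      (st i w (passWord b x) [] [] [] [] [] [] [] v) (B * (30 * B + 35) + 6 * B + 8) := by
  obtain ⟨m, n, k, hm, hn, hk, h⟩ := (runs_each_passStep (Q := Q) (kq := kq) (bitConst b) (B := B)
    (i := i) (w := w) (v := v) x).1 [] [] hx (by simp)
  have hl := (length_passOut (bitConst b) x [] []).1
  have hB : x.length * (30 * B + 35) ≤ B * (30 * B + 35) := Nat.mul_le_mul_right _ hx
  refine ((h.cons (Runs.cons (Runs.clear m (by rfl)) (Runs.cons (Runs.clear n (by rfl)) (Runs.cons
    (Runs.clear k (by rfl)) (Runs.cons (Runs.move (by decide) (passOut (bitConst b) x none [] [])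
      (by rfl)) Runs.nil))))).of_eq ?_).mono ?_
  · funext j; cases j <;> simp [st, passWord]
  · simp at hl; omega

theorem runs_each_pass {B : ℕ} {i v : List VSym} (w x : List VSym) (hx : x.length ≤ B) :
    (passWords w.reverse x).length ≤ x.length ∧
    Runs Q kq (.each .w pass) (st i w x [] [] [] [] [] [] [] v)
      (st i [] (passWords w.reverse x) [] [] [] [] [] [] [] v)
      (w.length * (B * (30 * B + 35) + 6 * B + 9) + 1) := by
  induction w generalizing x with
  | nil => exact ⟨le_rfl, (Runs.each_nil rfl).mono (by simp)⟩
  | cons b w ih =>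
    have hl := length_passWord b x
    obtain ⟨h₁, h₂⟩ := ih (passWord b x) (by omega)
    have e : passWords (b :: w).reverse x = passWords w.reverse (passWord b x) := by
      simp [passWords]
    rw [e]
    refine ⟨by omega, (Runs.each_cons (a := b) (l := w) (by rfl)
      ((runs_pass b hx).of_eq_left ?_) h₂).mono ?_⟩
    · funext j; cases j <;> rfl
    · simp only [List.length_cons, Nat.add_mul]; omega

theorem topVal_head (v : List Bool) :
    topVal (v.map (Sum.inr (α := Sym))).head? = v.headD false := by
  cases v <;> rfl

theorem runs_evalStep (s : VSym) {i w x o m n k k' a f : List VSym} (v : List Bool) :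
    Runs Q kq (evalStep s) (st i w x o m n k k' a f (v.map .inr))
      (st i w x o m n k k' a f ((valStep s v).map .inr)) 3 := by
  have hpush : ∀ b v, Runs Q kq (.push .v (.inr b)) (st i w x o m n k k' a f (v.map .inr))
      (st i w x o m n k k' a f ((b :: v).map .inr)) 1 := fun b v =>
    Runs.push.of_eq (by funext j; cases j <;> rfl)
  have hpop : ∀ (g : Option VSym → Prog VerStack VSym) (v : List Bool) s' B,
      Runs Q kq (g (v.map (Sum.inr (α := Sym))).head?)
        (st i w x o m n k k' a f (v.tail.map .inr)) s' B →
      Runs Q kq (.pop .v g) (st i w x o m n k k' a f (v.map .inr)) s' (B + 1) := by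
    intro g v s' B h
    refine Runs.pop (h.of_eq_left ?_)
    funext j; cases j <;> simp [st]
  have h0 : Runs Q kq .skip (st i w x o m n k k' a f (v.map .inr))
      (st i w x o m n k k' a f (v.map .inr)) 3 := Runs.skip.mono (by omega)
  rcases s with s | s
  · cases s
    case var => exact h0
    case bit => exact h0
    case close => exact (hpush _ _).mono (by omega)
    case tt => exact (hpush _ _).mono (by omega)
    case ff => exact (hpush _ _).mono (by omega)
    case uu => exact h0
    case neg => exact (hpop _ _ _ _ (by rw [topVal_head]; exact hpush _ _)).mono (by omega)
    case turnstile => exact (hpop _ _ _ _ (by rw [topVal_head]; exact hpush _ _)).mono (by omega)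
    case and =>
      refine hpop _ _ _ _ (hpop _ _ _ _ ?_)
      rw [topVal_head, topVal_head]; exact hpush _ _
    case or =>
      refine hpop _ _ _ _ (hpop _ _ _ _ ?_)
      rw [topVal_head, topVal_head]; exact hpush _ _
    case imp =>
      refine hpop _ _ _ _ (hpop _ _ _ _ ?_)
      rw [topVal_head, topVal_head]; exact hpush _ _
    case box => exact h0
    case sep => exact h0
  · exact h0

theorem length_valStep (s : VSym) (v : List Bool) : (valStep s v).length ≤ v.length + 1 := by
  unfold valStep
  split <;> simp <;> omega

theorem runs_each_evalStep {i w x m n k k' a f : List VSym} (o : List VSym) (v : List Bool) :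
    (o.foldl (fun v s => valStep s v) v).length ≤ o.length + v.length ∧
    Runs Q kq (.each .o evalStep) (st i w x o m n k k' a f (v.map .inr))
      (st i w x [] m n k k' a f ((o.foldl (fun v s => valStep s v) v).map .inr))
      (4 * o.length + 1) := by
  induction o generalizing v with
  | nil => exact ⟨by simp, Runs.each_nil rfl⟩
  | cons s o ih =>
    obtain ⟨h₁, h₂⟩ := ih (valStep s v)
    have hl := length_valStep s v
    refine ⟨by simp only [List.foldl_cons, List.length_cons]; omega,
      (Runs.each_cons (a := s) (l := o) (by rfl) ((runs_evalStep s v).of_eq_left ?_) h₂).mono ?_⟩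
    · funext j; cases j <;> rfl
    · simp only [List.length_cons]; omega

theorem runs_all {i w x o m n k k' a f : List VSym} (v : List Bool) :
    ∃ f', (f' = [] ↔ f = [] ∧ v.all id = true) ∧
      Runs Q kq (.each .v fun b => if b = .inr true then .skip else .push .f b)
        (st i w x o m n k k' a f (v.map .inr)) (st i w x o m n k k' a f' [])
        (2 * v.length + 1) := by
  induction v generalizing f with
  | nil => exact ⟨f, by simp, Runs.each_nil rfl⟩
  | cons b v ih =>
    cases b with
    | true =>
      obtain ⟨f', h₁, h₂⟩ := ih (f := f)
      have hb : Runs Q kq (if (Sum.inr true : VSym) = .inr true then .skip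
          else .push .f (.inr true)) (st i w x o m n k k' a f (v.map .inr))
          (st i w x o m n k k' a f (v.map .inr)) 1 := by
        rw [if_pos rfl]; exact Runs.skip
      refine ⟨f', by simpa using h₁, (Runs.each_cons (a := .inr true) (l := v.map .inr) (by rfl)
        (hb.of_eq_left ?_) h₂).mono ?_⟩
      · funext j; cases j <;> rfl
      · simp only [List.length_cons]; omega
    | false =>
      obtain ⟨f', h₁, h₂⟩ := ih (f := .inr false :: f)
      have hb : Runs Q kq (if (Sum.inr false : VSym) = .inr true then .skip
          else .push .f (.inr false)) (st i w x o m n k k' a f (v.map .inr))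
          (st i w x o m n k k' a (.inr false :: f) (v.map .inr)) 1 := by
        rw [if_neg (by simp)]
        exact Runs.push.of_eq (by funext j; cases j <;> rfl)
      refine ⟨f', by simpa using h₁, (Runs.each_cons (a := .inr false) (l := v.map .inr) (by rfl)
        (hb.of_eq_left ?_) h₂).mono ?_⟩
      · funext j; cases j <;> rfl
      · simp only [List.length_cons]; omega

/-- The certificate arrives on `w` in reverse order and is thus consumed from its last bit, which is
why `passWords` is a right fold. -/
theorem runs_split (u : List VSym) {w o : List VSym} :
    ∀ (y : List Sym) (z : List Bool), u = y.map .inl ++ z.map .inr →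
    Runs Q kq (.each .i splitStep) (st u w [] o [] [] [] [] [] [] [])
      (st [] ((z.map .inr).reverse ++ w) [] ((y.map .inl).reverse ++ o) [] [] [] [] [] [] [])
      (2 * u.length + 1) := by
  induction u generalizing w o with
  | nil =>
    intro y z h
    obtain ⟨h₁, h₂⟩ := List.append_eq_nil_iff.1 h.symm
    rw [h₁, h₂]
    exact Runs.each_nil rfl
  | cons s u ih =>
    intro y z h
    cases y with
    | cons c y =>
      simp only [List.map_cons, List.cons_append, List.cons.injEq] at h
      obtain ⟨rfl, rfl⟩ := h
      refine ((Runs.each_cons (k := .i) (body := splitStep) (a := Sum.inl c) (l := y.map Sum.inl ++ z.map Sum.inr) (by rfl)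
        (Runs.push.of_eq ?_) (ih (w := w) (o := .inl c :: o) y z rfl)).of_eq (by simp)).mono ?_
      · funext j; cases j <;> rfl
      · simp only [List.length_cons]; omega
    | nil =>
      cases z with
      | nil => simp at h
      | cons c z =>
        simp only [List.map_nil, List.nil_append, List.map_cons, List.cons.injEq] at h
        obtain ⟨rfl, rfl⟩ := h
        refine ((Runs.each_cons (k := .i) (body := splitStep)
          (s := st (.inr c :: z.map .inr) w [] o [] [] [] [] [] [] []) (a := Sum.inr c) (l := z.map Sum.inr) (by rfl)
          (Runs.push.of_eq ?_) (ih (w := .inr c :: w) (o := o) [] z rfl)).of_eq ?_).mono ?_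
        · funext j; cases j <;> rfl
        · simp
        · simp only [List.length_cons]; omega

theorem runs_verProg (xw : List Sym × List Bool) {N : ℕ} (hN : xw.1.length + xw.2.length = N) :
    ∃ s, Runs Q kq verProg
        (Function.update (fun _ => []) .i (xw.1.map .inl ++ xw.2.map .inr)) s
        (N * (N * (30 * N + 35) + 6 * N + 9) + 20 * N + 20) ∧
      s .v = [.inr (accepts xw)] := by
  obtain ⟨x, w⟩ := xw
  simp only at hN
  have h₁ := runs_split (Q := Q) (kq := kq) (w := []) (o := []) _ x w rfl
  have h₂ : Runs Q kq (move .o .x)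
      (st [] ((w.map .inr).reverse ++ []) [] ((x.map .inl).reverse ++ []) [] [] [] [] [] [] [])
      (st [] (w.map .inr).reverse (x.map .inl) [] [] [] [] [] [] [] [])
      (2 * ((x.map .inl).reverse ++ [] : List VSym).length + 1) :=
    (Runs.move (by decide) _ (by rfl)).of_eq (by funext j; cases j <;> simp [st])
  obtain ⟨hl, h₃⟩ := runs_each_pass (Q := Q) (kq := kq) (i := []) (v := []) (w.map .inr).reverse
    (x.map .inl) (B := N) (by simp; omega)
  rw [List.reverse_reverse] at hl h₃
  obtain ⟨y, hy⟩ : ∃ y, y = passWords (w.map .inr) (x.map .inl) := ⟨_, rfl⟩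
  rw [← hy] at hl h₃
  have h₄ : Runs Q kq (move .x .o) (st [] [] y [] [] [] [] [] [] [] [])
      (st [] [] [] y.reverse [] [] [] [] [] [] (([] : List Bool).map .inr)) (2 * y.length + 1) :=
    (Runs.move (by decide) _ (by rfl)).of_eq (by funext j; cases j <;> simp [st])
  obtain ⟨hl', h₅⟩ := runs_each_evalStep (Q := Q) (kq := kq) (i := []) (w := []) (x := []) (m := [])
    (n := []) (k := []) (k' := []) (a := []) (f := []) y.reverse []
  rw [List.foldl_reverse] at hl' h₅
  obtain ⟨f, hf, h₆⟩ := runs_all (Q := Q) (kq := kq) (i := []) (w := []) (x := []) (o := [])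
    (m := []) (n := []) (k := []) (k' := []) (a := []) (f := [])
    (y.foldr (fun s v => valStep s v) [])
  have hacc : accepts (x, w) = (y.foldr (fun s v => valStep s v) []).all id := by
    rw [hy]; rfl
  rw [← hacc] at hf
  have h₇ : Runs Q kq (.pop .f fun o => match o with
      | none => .push .v (.inr true)
      | some _ => .push .v (.inr false)) (st [] [] [] [] [] [] [] [] [] f [])
      (st [] [] [] [] [] [] [] [] [] f.tail [.inr (accepts (x, w))]) 2 := by
    cases f with
    | nil =>
      rw [(hf.1 rfl).2]
      exact (Runs.pop Runs.push).of_eq (by funext j; cases j <;> rfl)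
    | cons s f =>
      have : accepts (x, w) = false := by simpa using hf
      rw [this]
      exact (Runs.pop Runs.push).of_eq (by funext j; cases j <;> rfl)
  refine ⟨_, Runs.mono (Runs.cons (h₁.of_eq_left ?_) (h₂.cons (h₃.cons (h₄.cons (h₅.cons (h₆.cons
    (h₇.cons Runs.nil))))))) ?_, rfl⟩
  · funext j; cases j <;> rfl
  · have hB : (w.map (Sum.inr (α := Sym))).reverse.length * (N * (30 * N + 35) + 6 * N + 9) ≤
        N * (N * (30 * N + 35) + 6 * N + 9) := Nat.mul_le_mul_right _ (by simp; omega)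
    simp only [List.length_append, List.length_map, List.length_reverse, List.length_nil] at *
    omega

end Correctness

end Verifier

/-! ### The verifier on well-formed sequents -/

namespace Verifier

variable {At : Type u} (name : At → List Bool)

/-- The word for a list of tokens, each of which is an atom or a single symbol. -/
def flat (ts : List (At ⊕ Sym)) : List VSym :=
  ts.flatMap fun t => t.elim (fun a => (encAtom name a).map .inl) fun s => [.inl s]

/-- The tokens of a formula. -/
def tokens : Fol2 At → List (At ⊕ Sym)
  | .const c => [.inr (encBool c)]
  | .atom a => [.inl a]
  | .neg F => .inr .neg :: tokens F
  | .and F G => .inr .and :: (tokens F ++ tokens G)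
  | .or F G => .inr .or :: (tokens F ++ tokens G)
  | .imp F G => .inr .imp :: (tokens F ++ tokens G)

/-- The tokens of a sequent. -/
def sequentTokens (U : List (Fol2 At)) (F : Fol2 At) : List (At ⊕ Sym) :=
  (U.flatMap fun G => tokens G ++ [.inr .sep]) ++ .inr .turnstile :: tokens F

theorem flat_append (ts ts' : List (At ⊕ Sym)) :
    flat name (ts ++ ts') = flat name ts ++ flat name ts' := by
  simp [flat]

theorem flat_atom_cons (a : At) (ts : List (At ⊕ Sym)) :
    flat name (.inl a :: ts) = (encAtom name a).map .inl ++ flat name ts := by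
  simp [flat]

theorem flat_sym_cons (s : Sym) (ts : List (At ⊕ Sym)) :
    flat name (.inr s :: ts) = .inl s :: flat name ts := by
  simp [flat]

theorem flat_tokens (F : Fol2 At) :
    flat name (tokens F) = (encFol name encBool F).map .inl := by
  induction F with
  | const c => simp [tokens, flat, encFol]
  | atom a => simp [tokens, flat, encFol]
  | neg F ih => simp [tokens, flat_sym_cons, encFol, ih]
  | and F G ihF ihG => simp [tokens, flat_sym_cons, flat_append, encFol, ihF, ihG]
  | or F G ihF ihG => simp [tokens, flat_sym_cons, flat_append, encFol, ihF, ihG]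
  | imp F G ihF ihG => simp [tokens, flat_sym_cons, flat_append, encFol, ihF, ihG]

theorem flat_sequentTokens (U : List (Fol2 At)) (F : Fol2 At) :
    flat name (sequentTokens U F) = (encSequent name U F).map .inl := by
  induction U with
  | nil => simp [sequentTokens, encSequent, flat_sym_cons, flat_tokens]
  | cons G U ih =>
    simp only [sequentTokens, encSequent, List.flatMap_cons, List.append_assoc, List.map_append,
      flat_append, flat_tokens] at ih ⊢
    rw [ih]
    simp [flat]

/-- No token is the symbol that starts a name. -/
def NoVar (ts : List (At ⊕ Sym)) : Prop := .inr .var ∉ ts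

theorem noVar_tokens (F : Fol2 At) : NoVar (tokens F) := by
  unfold NoVar
  induction F with
  | const c => cases c <;> simp [tokens, encBool]
  | atom a => simp [tokens]
  | neg F ih => simpa [tokens] using ih
  | and F G ihF ihG => simp [tokens, ihF, ihG]
  | or F G ihF ihG => simp [tokens, ihF, ihG]
  | imp F G ihF ihG => simp [tokens, ihF, ihG]

theorem noVar_sequentTokens (U : List (Fol2 At)) (F : Fol2 At) : NoVar (sequentTokens U F) := by
  have h := fun G : Fol2 At => noVar_tokens G
  simp only [NoVar] at h
  simp [NoVar, sequentTokens, h]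

open Classical in
/-- Replace the atom `k`, or the first atom if `k` is `none`, by the constant `b`. -/
noncomputable def substTokens (b : Bool) : Option At → List (At ⊕ Sym) → List (At ⊕ Sym)
  | _, [] => []
  | k, .inr s :: ts => .inr s :: substTokens b k ts
  | k, .inl a :: ts =>
      (if a = k.getD a then .inr (encBool b) else .inl a) :: substTokens b (some (k.getD a)) ts

theorem noVar_substTokens (b : Bool) (k : Option At) {ts : List (At ⊕ Sym)} (h : NoVar ts) :
    NoVar (substTokens b k ts) := by
  unfold NoVar at *
  induction ts generalizing k with
  | nil => simp [substTokens]
  | cons t ts ih =>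
    simp only [List.mem_cons, not_or] at h
    cases t with
    | inl a =>
      simp only [substTokens, List.mem_cons, not_or]
      refine ⟨?_, ih _ h.2⟩
      split_ifs
      · cases b <;> simp [encBool]
      · simp
    | inr s =>
      simp only [substTokens, List.mem_cons, not_or]
      exact ⟨h.1, ih _ h.2⟩

/-- The contents of stack `k` of the verifier. -/
def keyWord (k : Option At) : List VSym :=
  k.elim [] fun a => .inl .close :: ((name a).map fun b => .inl (.bit b)).reverse

theorem passOut_bits (c : VSym) (l : List Bool) (x n k o : List VSym) :
    passOut c ((l.map fun b => .inl (.bit b)) ++ x) (some n) k o =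
      passOut c x (some ((l.map fun b => .inl (.bit b)).reverse ++ n)) k o := by
  induction l generalizing n with
  | nil => rfl
  | cons b l ih => simp [passOut, ih]

theorem passOut_close (c : VSym) (x n k o : List VSym) :
    passOut c (.inl .close :: x) (some n) k o =
      if .inl .close :: n = (if k = [] then .inl .close :: n else k) then
        passOut c x none (if k = [] then .inl .close :: n else k) (c :: o)
      else passOut c x none (if k = [] then .inl .close :: n else k)
        (.inl .close :: n ++ .inl .var :: o) := by
  rw [passOut, if_pos rfl]

variable {name}

theorem keyWord_injective (hname : Function.Injective name) : Function.Injective (keyWord name) := by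
  have hbit : Function.Injective fun b : Bool => (Sum.inl (Sym.bit b) : VSym) := by
    intro b b' h; simpa using h
  rintro (_ | a) (_ | a') h
  · rfl
  · simp [keyWord] at h
  · simp [keyWord] at h
  · simp only [keyWord, Option.elim_some, List.cons.injEq, List.reverse_inj, true_and] at h
    rw [hname (hbit.list_map h)]

/-- The machine compares reversed names with their closing symbol. By `keyWord_injective` this
amounts to comparing atoms, so the pass on words is substitution on tokens. `NoVar` prevents a bare
symbol from switching the mode. -/
theorem passOut_flat (hname : Function.Injective name) (b : Bool) (k : Option At)
    {ts : List (At ⊕ Sym)} (h : NoVar ts) (o : List VSym) :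
    passOut (.inl (encBool b)) (flat name ts) none (keyWord name k) o =
      (flat name (substTokens b k ts)).reverse ++ o := by
  unfold NoVar at h
  induction ts generalizing k o with
  | nil => simp [flat, passOut, substTokens]
  | cons t ts ih =>
    simp only [List.mem_cons, not_or] at h
    cases t with
    | inr s =>
      have hs : s ≠ .var := fun e => h.1 (by rw [e])
      simp [flat_sym_cons, passOut, substTokens, hs, ih _ h.2]
    | inl a =>
      have e : (encAtom name a).map (Sum.inl (β := Bool)) ++ flat name ts =
          .inl .var :: (((name a).map fun b => .inl (.bit b)) ++ .inl .close :: flat name ts) := by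
        simp [encAtom]
      have ek : (if keyWord name k = [] then keyWord name (some a) else keyWord name k) =
          keyWord name (some (k.getD a)) := by
        cases k <;> simp [keyWord]
      have ec : keyWord name (some a) = keyWord name (some (k.getD a)) ↔ a = k.getD a := by
        rw [(keyWord_injective hname).eq_iff, Option.some_inj]
      have en : (Sum.inl Sym.close : VSym) ::
          ((name a).map fun b => (Sum.inl (Sym.bit b) : VSym)).reverse =
            keyWord name (some a) := rfl
      rw [flat_atom_cons, e]
      rw [passOut, if_pos rfl, passOut_bits, List.append_nil, passOut_close, en, ek]
      by_cases hc : a = k.getD a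
      · rw [if_pos (ec.2 hc), ih _ h.2, substTokens, if_pos hc, flat_sym_cons]
        simp
      · rw [if_neg (mt ec.1 hc), ih _ h.2, substTokens, if_neg hc, flat_atom_cons]
        simp [keyWord, encAtom, Function.comp_def]

/-- Replace the first atoms by constants, starting with the last one of `w`. -/
noncomputable def substAll (w : List Bool) (ts : List (At ⊕ Sym)) : List (At ⊕ Sym) :=
  w.foldr (fun b ts => substTokens b none ts) ts

theorem passWords_flat (hname : Function.Injective name) (w : List Bool)
    {ts : List (At ⊕ Sym)} (h : NoVar ts) :
    NoVar (substAll w ts) ∧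
      passWords (w.map .inr) (flat name ts) = flat name (substAll w ts) := by
  induction w with
  | nil => exact ⟨h, rfl⟩
  | cons b w ih =>
    refine ⟨noVar_substTokens b none ih.1, ?_⟩
    have := passOut_flat hname b none ih.1 []
    simp only [passWords, List.map_cons, List.foldr_cons, substAll] at ih this ⊢
    rw [ih.2, passWord]
    simpa [bitConst, keyWord] using congrArg List.reverse this

/-- The values of a list of tokens, read from right to left. -/
def evalTokens (I : Interp At) (ts : List (At ⊕ Sym)) : List Bool :=
  ts.foldr (fun t v => t.elim (fun a => I a :: v) fun s => valStep (.inl s) v) []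

/-- In the word of an atom only `close` has an effect, pushing `false`; atoms that have not been
replaced are thus evaluated as false. -/
theorem foldr_valStep_flat (ts : List (At ⊕ Sym)) :
    (flat name ts).foldr valStep [] = evalTokens (fun _ => false) ts := by
  have hbits : ∀ (l : List Bool) v, (l.map fun b => (Sum.inl (Sym.bit b) : VSym)).foldr valStep v
      = v := by
    intro l v
    induction l with
    | nil => rfl
    | cons b l ih => simp [valStep, ih]
  induction ts with
  | nil => rfl
  | cons t ts ih =>
    cases t with
    | inr s => simp [flat_sym_cons, evalTokens] at ih ⊢; rw [ih]
    | inl a =>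
      have e : (encAtom name a).map (Sum.inl (β := Bool)) =
          .inl .var :: (((name a).map fun b => .inl (.bit b)) ++ [.inl .close]) := by
        simp [encAtom]
      rw [flat_atom_cons, List.foldr_append, ih, e]
      simp [hbits, valStep, evalTokens]

/-- Polish notation read from the right: both operands are on the stack of values, the left one on
top, when the connective is met. -/
theorem evalTokens_tokens_append (I : Interp At) (F : Fol2 At) (ts : List (At ⊕ Sym)) :
    evalTokens I (tokens F ++ ts) = Fol.eval I F :: evalTokens I ts := by
  induction F generalizing ts with
  | const c => cases c <;> rfl
  | atom a => rfl
  | neg F ih =>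
    have h := ih ts
    simp only [evalTokens, tokens, List.cons_append, List.foldr_cons] at h ⊢
    rw [h]; simp [valStep, Fol.eval]
  | and F G ihF ihG =>
    have h := ihF (tokens G ++ ts)
    rw [ihG] at h
    simp only [evalTokens, tokens, List.cons_append, List.foldr_cons, List.append_assoc] at h ⊢
    rw [h]; simp [valStep, Fol.eval]
  | or F G ihF ihG =>
    have h := ihF (tokens G ++ ts)
    rw [ihG] at h
    simp only [evalTokens, tokens, List.cons_append, List.foldr_cons, List.append_assoc] at h ⊢
    rw [h]; simp [valStep, Fol.eval]
  | imp F G ihF ihG =>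
    have h := ihF (tokens G ++ ts)
    rw [ihG] at h
    simp only [evalTokens, tokens, List.cons_append, List.foldr_cons, List.append_assoc] at h ⊢
    rw [h]; simp [valStep, Fol.eval]

/-- The turnstile negates the value of the goal, and `sep` does nothing. The final stack holds the
values of the axioms and the negated value of the goal, so all entries are true exactly at a
countermodel. -/
theorem evalTokens_sequentTokens (I : Interp At) (U : List (Fol2 At)) (F : Fol2 At) :
    (evalTokens I (sequentTokens U F)).all id = true ↔
      I ∈ Models {G | G ∈ U} ∧ Fol.eval I F = false := by
  have key : evalTokens I (sequentTokens U F) = U.map (Fol.eval I) ++ [!(Fol.eval I F)] := by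
    induction U with
    | nil =>
      have h := evalTokens_tokens_append I F []
      simp only [sequentTokens, evalTokens, List.flatMap_nil, List.nil_append, List.append_nil,
        List.foldr_cons] at h ⊢
      rw [h]; rfl
    | cons G U ih =>
      rw [List.map_cons, List.cons_append, ← ih, ← show evalTokens I (.inr .sep ::
        sequentTokens U F) = evalTokens I (sequentTokens U F) from rfl,
        ← evalTokens_tokens_append]
      simp [sequentTokens]
  rw [key]
  simp [Models]

/-- Substitution lemma, with `I'` the update of `I` at `a`. The first clause records that replacing
an atom by its own value changes nothing. -/
theorem evalTokens_substTokens_some (I : Interp At) (b : Bool) (a : At) (ts : List (At ⊕ Sym)) :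
    ∃ I' : Interp At, (I a = b → I' = I) ∧
      evalTokens I (substTokens b (some a) ts) = evalTokens I' ts := by
  classical
  refine ⟨Function.update I a b, fun h => by rw [← h, Function.update_eq_self], ?_⟩
  induction ts with
  | nil => rfl
  | cons t ts ih =>
    cases t with
    | inr s =>
      simp only [substTokens, evalTokens, List.foldr_cons] at ih ⊢
      rw [ih]
      rfl
    | inl a' =>
      simp only [substTokens, evalTokens, List.foldr_cons, Option.getD_some] at ih ⊢
      rw [ih]
      by_cases h : a' = a
      · subst h
        cases b <;> simp [encBool, valStep]
      · simp [h]

/-- The number of atoms in a list of tokens. -/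
def atomCount (ts : List (At ⊕ Sym)) : ℕ := ts.countP Sum.isLeft

theorem atomCount_atom_cons (a : At) (ts : List (At ⊕ Sym)) :
    atomCount (.inl a :: ts) = atomCount ts + 1 :=
  List.countP_cons_of_pos rfl

theorem atomCount_sym_cons (s : Sym) (ts : List (At ⊕ Sym)) :
    atomCount (.inr s :: ts) = atomCount ts :=
  List.countP_cons_of_neg (by simp)

theorem atomCount_substTokens_le (b : Bool) (k : Option At) (ts : List (At ⊕ Sym)) :
    atomCount (substTokens b k ts) ≤ atomCount ts := by
  induction ts generalizing k with
  | nil => simp [substTokens]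
  | cons t ts ih =>
    cases t with
    | inr s => simpa only [substTokens, atomCount_sym_cons] using ih k
    | inl a =>
      have := ih (some (k.getD a))
      rw [substTokens]
      split_ifs
      · rw [atomCount_sym_cons, atomCount_atom_cons]; omega
      · rw [atomCount_atom_cons, atomCount_atom_cons]; omega

/-- Replacing the first atom amounts to replacing one fixed atom. -/
theorem substTokens_none (ts : List (At ⊕ Sym)) :
    (atomCount ts = 0 ∧ ∀ b, substTokens b none ts = ts) ∨
      ∃ a, ∀ b, substTokens b none ts = substTokens b (some a) ts ∧
        atomCount (substTokens b none ts) < atomCount ts := by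
  induction ts with
  | nil => exact .inl ⟨rfl, fun _ => rfl⟩
  | cons t ts ih =>
    cases t with
    | inr s =>
      rcases ih with ⟨h₀, h⟩ | ⟨a, h⟩
      · exact .inl ⟨by rwa [atomCount_sym_cons], fun b => by simp [substTokens, h]⟩
      · refine .inr ⟨a, fun b => ⟨by simp [substTokens, (h b).1], ?_⟩⟩
        simpa only [substTokens, atomCount_sym_cons] using (h b).2
    | inl a =>
      refine .inr ⟨a, fun b => ⟨by simp [substTokens], ?_⟩⟩
      have := atomCount_substTokens_le b (some a) ts
      rw [atomCount_atom_cons]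
      simp only [substTokens, Option.getD_none, if_true, atomCount_sym_cons]
      omega

/-- Soundness of certificates: whatever the bits are, and however few, the evaluation after the
passes is evaluation of the original tokens in some interpretation. -/
theorem exists_evalTokens_substAll (w : List Bool) (ts : List (At ⊕ Sym)) (I : Interp At) :
    ∃ I' : Interp At, evalTokens I (substAll w ts) = evalTokens I' ts := by
  induction w generalizing I with
  | nil => exact ⟨I, rfl⟩
  | cons b w ih =>
    change ∃ I', evalTokens I (substTokens b none (substAll w ts)) = _
    rcases substTokens_none (substAll w ts) with ⟨-, h⟩ | ⟨a, h⟩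
    · rw [h]; exact ih I
    · obtain ⟨I₁, -, h₁⟩ := evalTokens_substTokens_some I b a (substAll w ts)
      rw [(h b).1, h₁]
      exact ih I₁

/-- Completeness of certificates: each bit is chosen as the value in `I` of the atom that the pass
replaces. The value of the sequent is kept and, as long as atoms remain, their number drops. -/
theorem exists_substAll (I : Interp At) (ts : List (At ⊕ Sym)) (n : ℕ) :
    ∃ w : List Bool, w.length = n ∧ evalTokens I (substAll w ts) = evalTokens I ts ∧
      atomCount (substAll w ts) ≤ atomCount ts - n := by
  induction n with
  | zero => exact ⟨[], rfl, rfl, le_rfl⟩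
  | succ n ih =>
    obtain ⟨w, hw, hv, hc⟩ := ih
    rcases substTokens_none (substAll w ts) with ⟨h₀, h⟩ | ⟨a, h⟩
    -- No atom is left, so the pass does nothing and its bit is arbitrary.
    · refine ⟨true :: w, by simp [hw], ?_, ?_⟩
      · change evalTokens I (substTokens true none (substAll w ts)) = _
        rw [h, hv]
      · change atomCount (substTokens true none (substAll w ts)) ≤ _
        rw [h, h₀]; omega
    · refine ⟨I a :: w, by simp [hw], ?_, ?_⟩
      · change evalTokens I (substTokens (I a) none (substAll w ts)) = _
        obtain ⟨I₁, h₁, h₂⟩ := evalTokens_substTokens_some I (I a) a (substAll w ts)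
        rw [(h _).1, h₂, h₁ rfl, hv]
      · change atomCount (substTokens (I a) none (substAll w ts)) ≤ _
        have := (h (I a)).2
        omega

theorem evalTokens_eq_of_atomCount {ts : List (At ⊕ Sym)} (h : atomCount ts = 0)
    (I I' : Interp At) : evalTokens I ts = evalTokens I' ts := by
  induction ts with
  | nil => rfl
  | cons t ts ih =>
    cases t with
    | inl a => simp [atomCount_atom_cons] at h
    | inr s =>
      have := ih (by rwa [atomCount_sym_cons] at h)
      simp only [evalTokens, List.foldr_cons] at this ⊢
      rw [this]
      rfl

theorem atomCount_le_length_flat (ts : List (At ⊕ Sym)) :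
    atomCount ts ≤ (flat name ts).length := by
  induction ts with
  | nil => simp [atomCount]
  | cons t ts ih =>
    cases t with
    | inl a => simp [atomCount_atom_cons, flat_atom_cons, encAtom]; omega
    | inr s => simp [atomCount_sym_cons, flat_sym_cons]; omega

/-- The language of the verifier: on well-formed sequents, unprovability. -/
def unprovLang : Set (List Sym) :=
  {x | ∃ w : List Bool, w.length ≤ (Polynomial.X : Polynomial ℕ).eval x.length ∧
    accepts (x, w) = true}

/-- Accepted certificates correspond to countermodels, which exist exactly for unprovable sequents
by soundness and completeness. -/
theorem encSequent_mem_unprovLang (hname : Function.Injective name) (U : List (Fol2 At))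
    (F : Fol2 At) : encSequent name U F ∈ unprovLang ↔ ¬ Prov {G | G ∈ U} F := by
  have hfin : {G | G ∈ U}.Finite := U.finite_toSet
  have hacc : ∀ w, accepts (encSequent name U F, w) =
      (evalTokens (fun _ => false) (substAll w (sequentTokens U F))).all id := by
    intro w
    simp only [accepts]
    rw [← flat_sequentTokens, (passWords_flat hname w (noVar_sequentTokens U F)).2,
      foldr_valStep_flat]
  have hlen : atomCount (sequentTokens U F) ≤ (encSequent name U F).length := by
    have := atomCount_le_length_flat (name := name) (sequentTokens U F)
    rwa [flat_sequentTokens, List.length_map] at this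
  rw [prov_iff hfin]
  push Not
  simp only [unprovLang, Set.mem_ofPred_eq, hacc, Polynomial.eval_X]
  constructor
  · rintro ⟨w, -, hw⟩
    obtain ⟨I, hI⟩ := exists_evalTokens_substAll w (sequentTokens U F) fun _ => false
    rw [hI, evalTokens_sequentTokens] at hw
    exact ⟨I, hw.1, by simp [hw.2]⟩
  · rintro ⟨I, hI, hF⟩
    obtain ⟨w, hw, hv, hc⟩ := exists_substAll I (sequentTokens U F) (encSequent name U F).length
    refine ⟨w, hw.le, ?_⟩
    -- A sequent has at most as many atom occurrences as its word has symbols, so these passes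
    -- remove all of them and the default value `false` plays no role.
    rw [evalTokens_eq_of_atomCount (by omega) _ I, hv, evalTokens_sequentTokens]
    exact ⟨hI, by simpa using hF⟩

/-- The language is defined as the projection of what the verifier accepts, so only its running time
has to be bounded. The program contains no query; the empty oracle and the choice of query stack are
immaterial. -/
theorem inNP_unprovLang : InNP unprovLang := by
  refine ⟨accepts, .X, ⟨Prog.toTM false verProg .i .v .a (Function.Embedding.refl _)
    Function.Embedding.inr Function.Embedding.ofIsEmpty,
    .X * (.X * (30 * .X + 35) + 6 * .X + 9) + 20 * .X + 21,
    .X * (.X * (30 * .X + 35) + 6 * .X + 9) + 20 * .X + 21, fun xw => ?_⟩, fun x => Iff.rfl⟩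
  obtain ⟨s, ⟨t, ht, he⟩, hs⟩ := runs_verProg (Q := {x | ((x ∈ List.map
    (Function.Embedding.ofIsEmpty : Empty ↪ VSym) '' (∅ : Set (List Empty))) ↔ false = false)})
    (kq := .a) xw rfl
  refine Prog.outputs_of_exec (Q := {x | ((x ∈ List.map (Function.Embedding.ofIsEmpty :
    Empty ↪ VSym) '' (∅ : Set (List Empty))) ↔ false = false)}) (fun _ => Iff.rfl) (t := t) (s := s) ?_ ?_ ?_
  · rwa [show List.map (Function.Embedding.refl (Sym ⊕ Bool)) _ = _ from List.map_id _]
  · simpa using hs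
  · simp; omega

end Verifier

/-! ### Unique readability -/

section Readability

variable {At : Type u} {name : At → List Bool}

theorem encAtom_append_inj (hname : Function.Injective name) {a a' : At} {r r' : List Sym}
    (h : encAtom name a ++ r = encAtom name a' ++ r') : a = a' ∧ r = r' := by
  have key : ∀ l l' : List Bool, l.map Sym.bit ++ .close :: r = l'.map Sym.bit ++ .close :: r' →
      l = l' ∧ r = r' := by
    intro l
    induction l with
    | nil => intro l' h; cases l' <;> simp_all
    | cons b l ih =>
      intro l' h
      cases l' with
      | nil => simp at h
      | cons b' l' =>
        simp only [List.map_cons, List.cons_append, List.cons.injEq, Sym.bit.injEq] at h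
        obtain ⟨rfl, h⟩ := h
        obtain ⟨rfl, hr⟩ := ih l' h
        exact ⟨rfl, hr⟩
  simp only [encAtom, List.cons_append, List.append_assoc, List.cons.injEq, true_and,
    List.nil_append] at h
  obtain ⟨h₁, h₂⟩ := key _ _ h
  exact ⟨hname h₁, h₂⟩

/-- Polish notation is prefix-free: the first symbol determines the outermost constructor. The
arbitrary remainders allow the induction to split off the left operand. -/
theorem encFol_append_inj (hname : Function.Injective name) {F F' : Fol2 At} {r r' : List Sym}
    (h : encFol name encBool F ++ r = encFol name encBool F' ++ r') : F = F' ∧ r = r' := by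
  induction F generalizing F' r r' with
  | const c =>
    cases F' with
    | const c' => cases c <;> cases c' <;> simp_all [encFol, encBool]
    | _ => cases c <;> simp [encFol, encBool, encAtom] at h
  | atom a =>
    cases F' with
    | atom a' =>
      obtain ⟨rfl, hr⟩ := encAtom_append_inj hname h
      exact ⟨rfl, hr⟩
    | const c' => cases c' <;> simp [encFol, encBool, encAtom] at h
    | _ => simp [encFol, encAtom] at h
  | neg F ih =>
    cases F' with
    | neg F' =>
      simp only [encFol, List.cons_append, List.cons.injEq, true_and] at h
      obtain ⟨rfl, hr⟩ := ih h
      exact ⟨rfl, hr⟩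
    | const c' => cases c' <;> simp [encFol, encBool] at h
    | _ => simp [encFol, encAtom] at h
  | and F G ihF ihG =>
    cases F' with
    | and F' G' =>
      simp only [encFol, List.cons_append, List.cons.injEq, true_and, List.append_assoc] at h
      obtain ⟨rfl, hG⟩ := ihF h
      obtain ⟨rfl, hr⟩ := ihG hG
      exact ⟨rfl, hr⟩
    | const c' => cases c' <;> simp [encFol, encBool] at h
    | _ => simp [encFol, encAtom] at h
  | or F G ihF ihG =>
    cases F' with
    | or F' G' =>
      simp only [encFol, List.cons_append, List.cons.injEq, true_and, List.append_assoc] at h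
      obtain ⟨rfl, hG⟩ := ihF h
      obtain ⟨rfl, hr⟩ := ihG hG
      exact ⟨rfl, hr⟩
    | const c' => cases c' <;> simp [encFol, encBool] at h
    | _ => simp [encFol, encAtom] at h
  | imp F G ihF ihG =>
    cases F' with
    | imp F' G' =>
      simp only [encFol, List.cons_append, List.cons.injEq, true_and, List.append_assoc] at h
      obtain ⟨rfl, hG⟩ := ihF h
      obtain ⟨rfl, hr⟩ := ihG hG
      exact ⟨rfl, hr⟩
    | const c' => cases c' <;> simp [encFol, encBool] at h
    | _ => simp [encFol, encAtom] at h

/-- No formula starts with the turnstile, so the end of the theory is recognizable. Injectivity is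
needed because `provLang` is an existential statement about words: a word must not encode a provable
sequent besides an unprovable one. -/
theorem encSequent_inj (hname : Function.Injective name) {U U' : List (Fol2 At)} {F F' : Fol2 At}
    (h : encSequent name U F = encSequent name U' F') : U = U' ∧ F = F' := by
  have hturn : ∀ (G : Fol2 At) (r l : List Sym), .turnstile :: l ≠ encFol name encBool G ++ r := by
    intro G r l h
    cases G with
    | const c => cases c <;> simp [encFol, encBool] at h
    | _ => simp [encFol, encAtom] at h
  induction U generalizing U' with
  | nil =>
    cases U' with
    | nil =>
      simp only [encSequent, List.flatMap_nil, List.nil_append, List.cons.injEq, true_and] at h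
      rw [← List.append_nil (encFol name encBool F), ← List.append_nil (encFol name encBool F')] at h
      exact ⟨rfl, (encFol_append_inj hname h).1⟩
    | cons G' U' =>
      simp only [encSequent, List.flatMap_nil, List.nil_append, List.flatMap_cons,
        List.append_assoc] at h
      exact absurd h (hturn _ _ _)
  | cons G U ih =>
    cases U' with
    | nil =>
      simp only [encSequent, List.flatMap_nil, List.nil_append, List.flatMap_cons,
        List.append_assoc] at h
      exact absurd h.symm (hturn _ _ _)
    | cons G' U' =>
      simp only [encSequent, List.flatMap_cons, List.append_assoc] at h
      obtain ⟨rfl, hU⟩ := encFol_append_inj hname h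
      simp only [List.cons_append, List.nil_append, List.cons.injEq, true_and] at hU
      obtain ⟨rfl, rfl⟩ := ih hU
      exact ⟨rfl, rfl⟩

theorem encSequent_mem_provLang (hname : Function.Injective name) (U : List (Fol2 At))
    (F : Fol2 At) : encSequent name U F ∈ provLang name ↔ Prov {G | G ∈ U} F := by
  constructor
  · rintro ⟨U', F', h, hp⟩
    obtain ⟨rfl, rfl⟩ := encSequent_inj hname h
    exact hp
  · exact fun h => ⟨U, F, rfl, h⟩

end Readability

/-! ### The fixpoint is computed in polynomial time with an oracle -/

section Complexity

variable {At : Type u} (name : At → List Bool)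

/-- The 3-FOL theory that represents the least fixpoint. -/
noncomputable def leastTheory (T : List (Modal At)) : List (Fol3 At) :=
  FixStack.fixTheory T ((encModalTheory name T).length + 1)

/-- The flag `sw` lets one program serve for an oracle that decides provability and, with exchanged
answers, for one that decides unprovability. -/
theorem polyTimeIn_leastTheory {O : Set (List Sym)} (sw : Bool)
    (hO : ∀ U F, (encSequent name U F ∈ O ↔ sw = false) ↔ Prov {G | G ∈ U} F) :
    PolyTimeIn O (encModalTheory name) (encFol3Theory name) (leastTheory name) := by
  refine ⟨Prog.toTM sw FixStack.fixProg .t .y .q (Function.Embedding.refl _)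
    (Function.Embedding.refl _) (Function.Embedding.refl _),
    (.X + 2) * ((.X + 2) * (80 * (.X + 2) + 130) + 8 * (.X + 2) + 7) + 3 * (.X + 2) + 11,
    (.X + 2) * ((.X + 2) * (80 * (.X + 2) + 130) + 8 * (.X + 2) + 7) + 3 * (.X + 2) + 11,
    fun T => ?_⟩
  obtain ⟨s, ⟨t, ht, he⟩, hs⟩ := FixStack.runs_fixProg name (Q := {x | (x ∈ List.map
    (Function.Embedding.refl Sym) '' O) ↔ sw = false}) (fun U F => by
      rw [← hO, show List.map (Function.Embedding.refl Sym) = id from List.map_id_fun,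
        Set.image_id]
      rfl) T rfl
  refine Prog.outputs_of_exec (Q := {x | (x ∈ List.map (Function.Embedding.refl Sym) '' O) ↔
    sw = false}) (fun _ => Iff.rfl) (t := t) (s := s) ?_ ?_ ?_
  · rwa [show List.map (Function.Embedding.refl Sym) _ = _ from List.map_id _]
  · rw [show List.map (Function.Embedding.refl Sym) _ = _ from List.map_id _]
    exact hs
  · simp; omega

/-- Every top-level literal occupies at least its own box. Hence the length of the input bounds the
number of iterations, and the program does not have to count literals. -/
theorem Modal.encard_top_le (F : Modal At) : F.top.encard ≤ (encModal name F).length := by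
  induction F with
  | atom a => simp [Modal.top]
  | neg F ih =>
    refine ih.trans ?_
    simp [encModal]
  | and F G ihF ihG =>
    refine (Set.encard_union_le _ _).trans ((add_le_add ihF ihG).trans ?_)
    simp [encModal]
  | or F G ihF ihG =>
    refine (Set.encard_union_le _ _).trans ((add_le_add ihF ihG).trans ?_)
    simp [encModal]
  | imp F G ihF ihG =>
    refine (Set.encard_union_le _ _).trans ((add_le_add ihF ihG).trans ?_)
    simp [encModal]
  | K F => simp [Modal.top, encModal]

theorem encard_topLiterals_le (T : List (Modal At)) :
    (topLiterals {F | F ∈ T}).encard ≤ (encModalTheory name T).length := by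
  induction T with
  | nil => simp [topLiterals]
  | cons F T ih =>
    have e : topLiterals {G | G ∈ F :: T} = F.top ∪ topLiterals {G | G ∈ T} := by
      ext H; simp [topLiterals]
    rw [e]
    refine (Set.encard_union_le _ _).trans ((add_le_add (F.encard_top_le name) ih).trans ?_)
    simp only [encModalTheory, List.flatMap_cons, List.length_append]
    exact_mod_cast (by omega)

/-- Stabilization occurs at some stage `k + 1 ≤ |T| + 1`, and the surplus rounds leave the fixpoint
unchanged. -/
theorem leastTheory_fixed (T : List (Modal At)) :
    Function.IsFixedPt (SD {F | F ∈ T}) {G | G ∈ leastTheory name T} ∧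
      IsLeast (Function.fixedPoints (D {F | F ∈ T})) (Bel {G | G ∈ leastTheory name T}) := by
  have hT : {F | F ∈ T}.Finite := T.finite_toSet
  obtain ⟨k, hk, h⟩ := exists_stage_fixed hT
  have hk' : k ≤ (encModalTheory name T).length := by
    exact_mod_cast hk.trans (encard_topLiterals_le name T)
  rw [leastTheory, FixStack.setOf_fixTheory, stage_eq_of_fixed h (by omega)]
  refine ⟨?_, isLeast_Bel_stage hT h⟩
  rw [Function.IsFixedPt, ← stage_succ, h]

end Complexity

end AEL

/-! ### The main theorem. -/

theorem mainTheorem4 (At : Type u) :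
    (∀ T : Set (AEL.Modal At), T.Finite →
      ∃ k : ℕ, (k : ℕ∞) ≤ (AEL.topLiterals T).encard ∧
        Function.IsFixedPt (AEL.SD T) ((AEL.SD T)^[k] (AEL.SD T {AEL.Fol.const AEL.TV.u})) ∧
        IsLeast (Function.fixedPoints (AEL.D T))
          (AEL.Bel ((AEL.SD T)^[k] (AEL.SD T {AEL.Fol.const AEL.TV.u})))) ∧
    (∀ name : At → List Bool, Function.Injective name →
      ∃ f : List (AEL.Modal At) → List (AEL.Fol3 At),
        (∀ T : List (AEL.Modal At),
          Function.IsFixedPt (AEL.SD {F | F ∈ T}) {G | G ∈ f T} ∧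
          IsLeast (Function.fixedPoints (AEL.D {F | F ∈ T})) (AEL.Bel {G | G ∈ f T})) ∧
        (∃ p : Polynomial ℕ, ∀ T : List (AEL.Modal At),
          (AEL.encFol3Theory name (f T)).length ≤
            p.eval (AEL.encModalTheory name T).length) ∧
        AEL.PolyTimeIn (AEL.provLang name)
          (AEL.encModalTheory name) (AEL.encFol3Theory name) f ∧
        AEL.InFDeltaP2 (AEL.encModalTheory name) (AEL.encFol3Theory name) f) := by
  refine ⟨fun T hT => ?_, fun name hname => ⟨AEL.leastTheory name, AEL.leastTheory_fixed name,
    ⟨.X + 2, fun T => ?_⟩, ?_, AEL.Sym, AEL.Verifier.unprovLang, AEL.Verifier.inNP_unprovLang, ?_⟩⟩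
  · obtain ⟨k, hk, h⟩ := AEL.exists_stage_fixed hT
    refine ⟨k, hk, ?_⟩
    -- The initial instance is itself one application to `{u}`, so `k` further iterations give stage
    -- `k + 1`.
    rw [← Function.iterate_succ_apply]
    refine ⟨?_, AEL.isLeast_Bel_stage hT h⟩
    rw [Function.IsFixedPt, ← Function.iterate_succ_apply' (AEL.SD T)]
    exact h
  · simpa [AEL.leastTheory] using AEL.FixStack.length_fixTheory_le name T _
  · exact AEL.polyTimeIn_leastTheory name false fun U F => by
      simpa using AEL.encSequent_mem_provLang hname U F
  -- Certificates witness unprovability, so here the answers of the oracle are exchanged.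
  · exact AEL.polyTimeIn_leastTheory name true fun U F => by
      simp [AEL.Verifier.encSequent_mem_unprovLang hname U F]
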